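/- Let $k\ge 7$ and let $K\subset\mathbb R^3$ be a nondegenerate tetrahedron with barycentric coordinates $\lambda_0,\dots,\lambda_3$. For each edge $e$ let $t$ be a unit tangent vector and $n_1,n_2$ orthonormal normal vectors; for each face $f$ (the face $f_i$ being opposite to the vertex $i$) let $n$ (respectively $n_i$) be a unit normal vector and $t_1,t_2$ orthonormal tangent vectors. On an edge or face, $\lambda_0,\lambda_1$ or $\lambda_0,\lambda_1,\lambda_2$ denote its own barycentric coordinates. Write $(\cdot,\cdot)_\omega$ for the $L^2$ inner product on $\omega$, $\mathbb S$ and $\mathbb S_{2\times2}$ for the symmetric $3\times 3$ and $2\times 2$ matrices, $RT=\{a+b\,\mathbf x: a\in\mathbb R^3,\ b\in\mathbb R\}$, and $A/B=\{u\in A:(u,v)_\omega=0\ \forall v\in B\}$. For a face or for $K$, let $P^{(0)}_{k-3}$ be the space of polynomials of degree at most $k-3$ that vanish at all its vertices. On a face use coordinates along $t_1,t_2$, with gradient $\nabla_f$, Hessian $\operatorname{hess}_f$ and $\operatorname{rot}_f v=-\partial_{t_1}v_2+\partial_{t_2}v_1$ (applied rowwise to matrices), and put $E_f v=(v\cdot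 t_1,v\cdot t_2)^T$, $\mathbb E_f\sigma=(t_a^T\sigma t_b)_{a,b=1,2}$. The operator $\operatorname{curl}$ acts rowwise, and $\mathcal P_X$ is the $L^2$-orthogonal projection onto $X$. Let $$X_f=\operatorname{hess}_f\big[(\lambda_0\lambda_1\lambda_2)^3P_{k-7}(f)\big],\quad Y_f=\nabla_f\big[(\lambda_0\lambda_1\lambda_2)^2P_{k-5}(f)\big],\quad Z=\operatorname{hess}\big[(\lambda_0\lambda_1\lambda_2\lambda_3)^2P_{k-6}(K)\big],$$ $$B=\sum_{i=0}^3\lambda_j\lambda_l\lambda_mP^{(0)}_{k-3}(K)\,n_in_i^T+\lambda_0\lambda_1\lambda_2\lambda_3P_{k-4}(K;\mathbb S),\qquad \{i,j,l,m\}=\{0,1,2,3\}.$$ The degrees of freedom of $\sigma\in P_k(K;\mathbb S)$ are: - (5a) $(\sigma t,w)_e$ for $w\in RT$, on each edge $e$; - (5b) $D^\alpha\sigma(x)$ for $0\le|\alpha|\le2$, at each vertex $x$; - (5c) $(t^T\sigma t,p)_e$ for $p\in(\lambda_0\lambda_1)^3P_{k-6}(e)/P_1(e)$, on each edge $e$;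 - (5d) $(n_j^T\sigma t,p)_e$ for $p\in(\lambda_0\lambda_1)^3P_{k-6}(e)/P_0(e)$ and $j=1,2$, on each edge $e$; - (5e) $(n_j^T\sigma n_{j'},p)_e$ for $p\in(\lambda_0\lambda_1)^3P_{k-6}(e)$ and $1\le j\le j'\le 2$, on each edge $e$; - (5f) $(\mathcal P_{X_f}\mathbb E_f\sigma,\mathcal P_{X_f}\eta)_f+(\operatorname{rot}_f\mathbb E_f\sigma,\operatorname{rot}_f\eta)_f$ for $\eta\in(\lambda_0\lambda_1\lambda_2)P^{(0)}_{k-3}(f;\mathbb S_{2\times2})$, on each face $f$; - (5g) $(\mathcal P_{Y_f}E_f(\sigma n),\mathcal P_{Y_f}w)_f+(\operatorname{rot}_fE_f(\sigma n),\operatorname{rot}_fw)_f$ for $w\in(\lambda_0\lambda_1\lambda_2)P^{(0)}_{k-3}(f;\mathbb R^2)$, on each face $f$; - (5h) $(\mathcal P_{Z}\sigma,\mathcal P_{Z}\eta)_K+(\operatorname{curl}\sigma,\operatorname{curl}\eta)_K$ for $\eta\in B$. **Proposition.** Assume that the bilinear forms $(\mathcal P_{X_f}\xi,\mathcal P_{X_f}\eta)_f+(\operatorname{rot}_f\xi,\operatorname{rot}_f\eta)_f$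 and $(\mathcal P_{Y_f}v,\mathcal P_{Y_f}w)_f+(\operatorname{rot}_fv,\operatorname{rot}_fw)_f$ (for every face $f$) and $(\mathcal P_{Z}\xi,\mathcal P_{Z}\eta)_K+(\operatorname{curl}\xi,\operatorname{curl}\eta)_K$ are inner products on $(\lambda_0\lambda_1\lambda_2)P^{(0)}_{k-3}(f;\mathbb S_{2\times2})$, $(\lambda_0\lambda_1\lambda_2)P^{(0)}_{k-3}(f;\mathbb R^2)$ and $B$, respectively. Then the degrees of freedom (5a)–(5h) are unisolvent for $P_k(K;\mathbb S)$: the linear map sending $\sigma\in P_k(K;\mathbb S)$ to the collection of its degrees of freedom (each family of moments being regarded as a linear functional on its test space) is a bijection onto the space of all possible values. Moreover the total number of degrees of freedom and $\dim P_k(K;\mathbb S)$ both equal $(k+1)(k+2)(k+3)$. -/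

import Mathlib

open MvPolynomial MeasureTheory

namespace HuCurl

noncomputable section

/-! ### Polynomials and polynomial fields in `d` variables -/

/-- Real polynomials in `d` variables. -/
abbrev Poly (d : ℕ) : Type := MvPolynomial (Fin d) ℝ

/-- `P_m`: polynomials of total degree at most `m` in `d` variables. -/
def Pk (d m : ℕ) : Submodule ℝ (Poly d) := restrictTotalDegree (Fin d) ℝ m

/-- The symmetric `d × d` matrices all of whose entries lie in `W`. -/
def symIn {d : ℕ} {A : Type} [AddCommGroup A] [Module ℝ A] (W : Submodule ℝ A) :
    Submodule ℝ (Matrix (Fin d) (Fin d) A) where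
  carrier := {s | s.IsSymm ∧ ∀ i j, s i j ∈ W}
  add_mem' := fun ha hb =>
    ⟨ha.1.add hb.1, fun i j => W.add_mem (ha.2 i j) (hb.2 i j)⟩
  zero_mem' := ⟨Matrix.isSymm_zero, fun _ _ => W.zero_mem⟩
  smul_mem' := fun c _ ha => ⟨ha.1.smul c, fun i j => W.smul_mem c (ha.2 i j)⟩

/-- The vector fields all of whose `d` components lie in `W`. -/
def vecIn {d : ℕ} {A : Type} [AddCommGroup A] [Module ℝ A] (W : Submodule ℝ A) :
    Submodule ℝ (Fin d → A) :=
  Submodule.pi Set.univ fun _ => W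

/-- The real symmetric `3 × 3` matrices. -/
abbrev Sym3 : Submodule ℝ (Matrix (Fin 3) (Fin 3) ℝ) := symIn ⊤

/-- `P_k(K; 𝕊)`: symmetric-matrix-valued polynomials of degree at most `k` in three variables. -/
abbrev PkS (k : ℕ) : Submodule ℝ (Matrix (Fin 3) (Fin 3) (Poly 3)) := symIn (Pk 3 k)

/-- The lowest order Raviart-Thomas fields `a + b x` on `ℝ³`. -/
def RT : Submodule ℝ (Fin 3 → Poly 3) where
  carrier := {w | ∃ (a : Fin 3 → ℝ) (b : ℝ), ∀ i, w i = C (a i) + C b * X i}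
  add_mem' := by
    rintro v w ⟨a, b, h⟩ ⟨a', b', h'⟩
    refine ⟨a + a', b + b', fun i => ?_⟩
    simp only [Pi.add_apply, h, h', map_add]
    ring
  zero_mem' := ⟨0, 0, fun i => by simp⟩
  smul_mem' := by
    rintro c w ⟨a, b, h⟩
    refine ⟨c • a, c * b, fun i => ?_⟩
    simp only [Pi.smul_apply, h, smul_eq_mul, map_mul, MvPolynomial.smul_eq_C_mul]
    ring

/-! ### Differential operators -/

/-- The partial derivative with respect to the `i`-th variable. -/
def pd {d : ℕ} (i : Fin d) : Poly d →ₗ[ℝ] Poly d := (pderiv (R := ℝ) i).toLinearMap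

/-- `D^α = ∂₁^{α₁} ∂₂^{α₂} ∂₃^{α₃}`. -/
def mpd (a : Fin 3 → ℕ) : Poly 3 →ₗ[ℝ] Poly 3 :=
  ((pd 0) ^ (a 0)) ∘ₗ ((pd 1) ^ (a 1)) ∘ₗ ((pd 2) ^ (a 2))

/-- The gradient. -/
def grad (d : ℕ) : Poly d →ₗ[ℝ] (Fin d → Poly d) := LinearMap.pi fun i => pd i

/-- The Hessian. -/
def hess (d : ℕ) : Poly d →ₗ[ℝ] Matrix (Fin d) (Fin d) (Poly d) where
  toFun u := Matrix.of fun i j => pd i (pd j u)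
  map_add' u v := by ext1 i j; simp
  map_smul' c u := by ext1 i j; simp

/-- `rot v = - ∂₁ v₂ + ∂₂ v₁` in two variables. -/
def rot : (Fin 2 → Poly 2) →ₗ[ℝ] Poly 2 where
  toFun v := -pd 0 (v 1) + pd 1 (v 0)
  map_add' v w := by simp only [Pi.add_apply, map_add]; ring
  map_smul' c v := by simp

/-- The rowwise `rot` of a `2 × 2` matrix field. -/
def rotRow : Matrix (Fin 2) (Fin 2) (Poly 2) →ₗ[ℝ] (Fin 2 → Poly 2) where
  toFun s := fun i => rot (s i)
  map_add' s t := by funext i; exact map_add rot (s i) (t i)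
  map_smul' c s := by funext i; exact map_smul rot c (s i)

/-- The curl of a vector field in three variables. -/
def curl (v : Fin 3 → Poly 3) : Fin 3 → Poly 3 :=
  ![pd 1 (v 2) - pd 2 (v 1), pd 2 (v 0) - pd 0 (v 2), pd 0 (v 1) - pd 1 (v 0)]

/-- The rowwise curl of a `3 × 3` matrix field. -/
def curlRow : Matrix (Fin 3) (Fin 3) (Poly 3) →ₗ[ℝ] Matrix (Fin 3) (Fin 3) (Poly 3) where
  toFun s := Matrix.of fun i => curl (s i)
  map_add' s t := by
    ext1 i j
    fin_cases j <;> simp [curl] <;> ring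
  map_smul' c s := by
    ext1 i j
    fin_cases j <;> simp [curl, smul_sub]

/-! ### `L²` inner products on simplices and orthogonal projections -/

/-- The full-dimensional simplex (in `ℝ^d`) with the vertices `v`. -/
def simplexSet {n d : ℕ} (v : Fin n → Fin d → ℝ) : Set (Fin d → ℝ) :=
  convexHull ℝ (Set.range v)

lemma integrableOn_eval {n d : ℕ} (v : Fin n → Fin d → ℝ) (p : Poly d) :
    IntegrableOn (fun s => eval s p) (simplexSet v) volume :=
  (MvPolynomial.continuous_eval p).continuousOn.integrableOn_compact
    ((Set.finite_range v).isCompact_convexHull (𝕜 := ℝ))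

/-- The integral of a polynomial over the simplex with the vertices `v`, as a linear map. -/
def simplexInt {n d : ℕ} (v : Fin n → Fin d → ℝ) : Poly d →ₗ[ℝ] ℝ where
  toFun p := ∫ s in simplexSet v, eval s p
  map_add' p q := by
    simp only [map_add]
    exact integral_add (integrableOn_eval v p) (integrableOn_eval v q)
  map_smul' c p := by
    simp only [MvPolynomial.smul_eval, RingHom.id_apply, smul_eq_mul]
    exact integral_const_mul c _

/-- `(p, q) = ∫ p q` for scalar polynomials on the simplex with the vertices `v`. -/
def l2 {n d : ℕ} (v : Fin n → Fin d → ℝ) : LinearMap.BilinForm ℝ (Poly d) :=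
  (LinearMap.mul ℝ (Poly d)).compr₂ (simplexInt v)

/-- `(p, q) = ∫ p ⬝ q` for vector fields. -/
def l2Vec {n d : ℕ} (v : Fin n → Fin d → ℝ) (m : ℕ) :
    LinearMap.BilinForm ℝ (Fin m → Poly d) :=
  ∑ i, (l2 v).compl₁₂ (LinearMap.proj i) (LinearMap.proj i)

/-- `(s, t) = ∫ s : t` for matrix fields. -/
def l2Mat {n d : ℕ} (v : Fin n → Fin d → ℝ) (m : ℕ) :
    LinearMap.BilinForm ℝ (Matrix (Fin m) (Fin m) (Poly d)) :=
  ∑ i, ∑ j, (l2 v).compl₁₂ (Matrix.entryLinearMap ℝ (Poly d) i j)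
    (Matrix.entryLinearMap ℝ (Poly d) i j)

open Classical in
/-- The `B`-orthogonal projection onto `W`: the projection onto `W` along its `B`-orthogonal
complement. It is well defined as soon as `W` is finite-dimensional and `B` is positive definite
on `W`, see `orthProj_mem` and `orthProj_orth`; otherwise it is set to zero. -/
def orthProj {M : Type} [AddCommGroup M] [Module ℝ M] (B : LinearMap.BilinForm ℝ M)
    (W : Submodule ℝ M) : M →ₗ[ℝ] M :=
  if h : IsCompl W (B.orthogonal W) then W.projection (B.orthogonal W) h else 0

lemma orthProj_isCompl {M : Type} [AddCommGroup M] [Module ℝ M] {B : LinearMap.BilinForm ℝ M}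
    {W : Submodule ℝ M} [FiniteDimensional ℝ W] (hs : ∀ u v, B u v = B v u)
    (hp : ∀ w ∈ W, B w w = 0 → w = 0) : IsCompl W (B.orthogonal W) := by
  refine isCompl_iff.2 ⟨Submodule.disjoint_def.2 fun w hw hw' => hp w hw (hw' w hw), ?_⟩
  have hinj : Function.Injective (B.domRestrict₁₂ W W) := by
    refine (injective_iff_map_eq_zero _).2 fun w hw => ?_
    exact Subtype.ext (hp w w.2 (LinearMap.congr_fun hw w))
  have hsur : Function.Surjective (B.domRestrict₁₂ W W) :=
    (LinearMap.injective_iff_surjective_of_finrank_eq_finrank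
      (Subspace.dual_finrank_eq (K := ℝ) (V := W)).symm).1 hinj
  refine codisjoint_iff.2 (eq_top_iff.2 fun u _ => ?_)
  obtain ⟨w, hw⟩ := hsur ((B u).domRestrict W)
  refine Submodule.mem_sup.2 ⟨w, w.2, u - w, fun z hz => ?_, by abel⟩
  have h : B w z = B u z := LinearMap.congr_fun hw ⟨z, hz⟩
  show B z (u - w) = 0
  rw [map_sub, hs z u, hs z w, h, sub_self]

lemma orthProj_mem {M : Type} [AddCommGroup M] [Module ℝ M] (B : LinearMap.BilinForm ℝ M)
    (W : Submodule ℝ M) (u : M) : orthProj B W u ∈ W := by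
  unfold orthProj
  split_ifs with h
  · exact Submodule.projection_apply_mem h u
  · exact W.zero_mem

lemma orthProj_orth {M : Type} [AddCommGroup M] [Module ℝ M] {B : LinearMap.BilinForm ℝ M}
    {W : Submodule ℝ M} [FiniteDimensional ℝ W] (hs : ∀ u v, B u v = B v u)
    (hp : ∀ w ∈ W, B w w = 0 → w = 0) (u : M) {w : M} (hw : w ∈ W) :
    B w (u - orthProj B W u) = 0 := by
  have h := orthProj_isCompl hs hp
  rw [orthProj, dif_pos h]
  exact Submodule.sub_projection_mem h u w hw

/-- `B` is an inner product on the space `W`: symmetric and positive definite there. -/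
def IsInnerProductOn {M : Type} [AddCommGroup M] [Module ℝ M] (B : LinearMap.BilinForm ℝ M)
    (W : Submodule ℝ M) : Prop :=
  (∀ u ∈ W, ∀ v ∈ W, B u v = B v u) ∧ ∀ u ∈ W, u ≠ 0 → 0 < B u u

/-- The space `W / Z` of those elements of `W` that are `B`-orthogonal to all of `Z`. -/
def perpIn {M : Type} [AddCommGroup M] [Module ℝ M] (B : LinearMap.BilinForm ℝ M)
    (W Z : Submodule ℝ M) : Submodule ℝ M where
  carrier := {u | u ∈ W ∧ ∀ z ∈ Z, B u z = 0}
  add_mem' := fun ha hb => ⟨W.add_mem ha.1 hb.1, fun z hz => by simp [ha.2 z hz, hb.2 z hz]⟩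
  zero_mem' := ⟨W.zero_mem, fun z _ => by simp⟩
  smul_mem' := fun c _ ha => ⟨W.smul_mem c ha.1, fun z hz => by simp [ha.2 z hz]⟩

/-- The space `p W = {p q : q ∈ W}`. -/
def mulBy {d : ℕ} (p : Poly d) (W : Submodule ℝ (Poly d)) : Submodule ℝ (Poly d) :=
  W.map (LinearMap.mulLeft ℝ p)

/-- `P_m^{(0)}`: polynomials of degree at most `m` that vanish at all the points `v`. -/
def P0 {n d : ℕ} (v : Fin n → Fin d → ℝ) (m : ℕ) : Submodule ℝ (Poly d) where
  carrier := {p | p ∈ Pk d m ∧ ∀ j, eval (v j) p = 0}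
  add_mem' := fun ha hb =>
    ⟨(Pk d m).add_mem ha.1 hb.1, fun j => by simp [ha.2 j, hb.2 j]⟩
  zero_mem' := ⟨(Pk d m).zero_mem, fun j => by simp⟩
  smul_mem' := fun c _ ha => ⟨(Pk d m).smul_mem c ha.1, fun j => by simp [ha.2 j]⟩

/-! ### The tetrahedron, its edges and faces, and local frames -/

/-- A nondegenerate (closed) tetrahedron in `ℝ³`, given by its four vertices, which are affinely
independent (and hence affinely span `ℝ³`). -/
abbrev Tet : Type := AffineBasis (Fin 4) ℝ (Fin 3 → ℝ)

/-- The six edges of a tetrahedron, as pairs of vertex indices. -/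
abbrev Edge : Type := {e : Fin 4 × Fin 4 // e.1 < e.2}

/-- A choice of unit tangent and normal vectors on the edges and faces of `K`.
The face `i` is the one opposite to the vertex `i`. -/
structure Frame (K : Tet) where
  /-- the unit tangential vector of an edge -/
  t : Edge → Fin 3 → ℝ
  /-- the two orthonormal normal vectors of an edge -/
  nE : Edge → Fin 2 → Fin 3 → ℝ
  /-- the unit normal vector of a face -/
  n : Fin 4 → Fin 3 → ℝ
  /-- the two orthonormal tangential vectors of a face -/
  tF : Fin 4 → Fin 2 → Fin 3 → ℝ
  t_unit : ∀ e, t e ⬝ᵥ t e = 1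
  t_tangent : ∀ e, ∃ c : ℝ, K e.1.2 - K e.1.1 = c • t e
  nE_orthonormal : ∀ e a b, nE e a ⬝ᵥ nE e b = if a = b then 1 else 0
  nE_normal : ∀ e a, nE e a ⬝ᵥ t e = 0
  n_unit : ∀ i, n i ⬝ᵥ n i = 1
  n_normal : ∀ i j l, j ≠ i → l ≠ i → n i ⬝ᵥ (K j - K l) = 0
  tF_orthonormal : ∀ i a b, tF i a ⬝ᵥ tF i b = if a = b then 1 else 0
  tF_tangent : ∀ i a, tF i a ⬝ᵥ n i = 0

/-- The barycentric coordinate `λ_i` of `K` as a polynomial on `ℝ³`. -/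
def bary (K : Tet) (i : Fin 4) : Poly 3 :=
  C (K.coord i 0) + ∑ l, C ((K.coord i).linear (Pi.single l 1)) * X l

/-- The restriction of a polynomial to the affine subspace `x₀ + span τ`, expressed in the
coordinates `s ↦ x₀ + ∑ s_m τ_m`. -/
def restr {d : ℕ} (x₀ : Fin 3 → ℝ) (τ : Fin d → Fin 3 → ℝ) : Poly 3 →ₐ[ℝ] Poly d :=
  aeval fun i => C (x₀ i) + ∑ m, C (τ m i) * X m

/-- The coordinates of the points `x` with respect to the origin `x 0` and the orthonormal
vectors `τ`. -/
def localPts {n d : ℕ} (x : Fin (n + 1) → Fin 3 → ℝ) (τ : Fin d → Fin 3 → ℝ) :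
    Fin (n + 1) → Fin d → ℝ :=
  fun j m => (x j - x 0) ⬝ᵥ τ m

/-- The scalar component `aᵀ σ b` of a matrix field. -/
def comp (a b : Fin 3 → ℝ) : Matrix (Fin 3) (Fin 3) (Poly 3) →ₗ[ℝ] Poly 3 :=
  ∑ i, ∑ j, (a i * b j) • Matrix.entryLinearMap ℝ (Poly 3) i j

variable (K : Tet) (F : Frame K) (k : ℕ)

/-- The vertices of the edge `e`. -/
def edgeVert (e : Edge) : Fin 2 → Fin 3 → ℝ := ![K e.1.1, K e.1.2]

/-- The vertices of the face `i`. -/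
def faceVert (i : Fin 4) : Fin 3 → Fin 3 → ℝ := fun j => K (i.succAbove j)

variable {K}

/-- The arc length coordinates of the vertices of the edge `e`. -/
def edgePts (e : Edge) : Fin 2 → Fin 1 → ℝ := localPts (edgeVert K e) fun _ => F.t e

/-- Restriction of a polynomial to the edge `e`, in the arc length coordinate. -/
def edgeRestr (e : Edge) : Poly 3 →ₐ[ℝ] Poly 1 := restr (edgeVert K e 0) fun _ => F.t e

/-- The coordinates of the vertices of the face `i` with respect to its tangential vectors. -/
def facePts (i : Fin 4) : Fin 3 → Fin 2 → ℝ := localPts (faceVert K i) (F.tF i)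

/-- Restriction of a polynomial to the face `i`, in the coordinates along the tangential vectors;
the partial derivatives of the result are the tangential derivatives on the face. -/
def faceRestr (i : Fin 4) : Poly 3 →ₐ[ℝ] Poly 2 := restr (faceVert K i 0) (F.tF i)

/-! ### Bubble spaces -/

/-- The edge bubble `λ₀ λ₁`. -/
def edgeBub (e : Edge) : Poly 1 := edgeRestr F e (bary K e.1.1 * bary K e.1.2)

/-- The face bubble `λ₀ λ₁ λ₂`. -/
def faceBub (i : Fin 4) : Poly 2 := faceRestr F i (∏ j : Fin 3, bary K (i.succAbove j))

/-- `(λ₀ λ₁)³ P_{k-6}(e)`. -/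
def edgeSpace (e : Edge) : Submodule ℝ (Poly 1) := mulBy (edgeBub F e ^ 3) (Pk 1 (k - 6))

/-- `(λ₀ λ₁)³ P_{k-6}(e) / P_m(e)`. -/
def edgeSpaceMod (m : ℕ) (e : Edge) : Submodule ℝ (Poly 1) :=
  perpIn (l2 (edgePts F e)) (edgeSpace F k e) (Pk 1 m)

/-- `(λ₀ λ₁ λ₂) P_{k-3}^{(0)}(f)`. -/
def faceSpace (i : Fin 4) : Submodule ℝ (Poly 2) :=
  mulBy (faceBub F i) (P0 (facePts F i) (k - 3))

/-- `(λ₀ λ₁ λ₂) P_{k-3}^{(0)}(f; 𝕊)` with symmetric `2 × 2` matrices. -/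
abbrev faceSpaceS (i : Fin 4) : Submodule ℝ (Matrix (Fin 2) (Fin 2) (Poly 2)) :=
  symIn (faceSpace F k i)

/-- `(λ₀ λ₁ λ₂) P_{k-3}^{(0)}(f; ℝ²)`. -/
abbrev faceSpaceV (i : Fin 4) : Submodule ℝ (Fin 2 → Poly 2) := vecIn (faceSpace F k i)

variable (K) in
/-- The cell bubble `λ₀ λ₁ λ₂ λ₃`. -/
def cellBub : Poly 3 := ∏ j, bary K j

/-- The matrix field `p n_i n_iᵀ`. -/
def nnT (i : Fin 4) : Poly 3 →ₗ[ℝ] Matrix (Fin 3) (Fin 3) (Poly 3) where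
  toFun p := Matrix.of fun a b => (F.n i a * F.n i b) • p
  map_add' p q := by ext1 a b; simp
  map_smul' c p := by ext1 a b; simp [smul_comm c]

/-- The cell bubble space: the sum over the faces `i` of
`λ_j λ_l λ_m P_{k-3}^{(0)}(K) n_i n_iᵀ`, where `{i, j, l, m} = {0, 1, 2, 3}`, plus
`λ₀ λ₁ λ₂ λ₃ P_{k-4}(K; 𝕊)`. -/
def cellSpace : Submodule ℝ (Matrix (Fin 3) (Fin 3) (Poly 3)) :=
  (⨆ i : Fin 4, (mulBy (∏ j : Fin 3, bary K (i.succAbove j)) (P0 K (k - 3))).map (nnT F i)) ⊔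
    symIn (mulBy (cellBub K) (Pk 3 (k - 4)))

/-! ### The bilinear forms of the face and cell degrees of freedom -/

/-- `hess_f ((λ₀ λ₁ λ₂)³ P_{k-7}(f))`. -/
def faceHess (i : Fin 4) : Submodule ℝ (Matrix (Fin 2) (Fin 2) (Poly 2)) :=
  (mulBy (faceBub F i ^ 3) (Pk 2 (k - 7))).map (hess 2)

/-- `grad_f ((λ₀ λ₁ λ₂)² P_{k-5}(f))`. -/
def faceGrad (i : Fin 4) : Submodule ℝ (Fin 2 → Poly 2) :=
  (mulBy (faceBub F i ^ 2) (Pk 2 (k - 5))).map (grad 2)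

variable (K) in
/-- `hess ((λ₀ λ₁ λ₂ λ₃)² P_{k-6}(K))`. -/
def cellHess : Submodule ℝ (Matrix (Fin 3) (Fin 3) (Poly 3)) :=
  (mulBy (cellBub K ^ 2) (Pk 3 (k - 6))).map (hess 3)

/-- `(𝒫 s, 𝒫 t)_f + (rot_f s, rot_f t)_f`, with `𝒫` the `L²(f)`-projection onto
`hess_f ((λ₀ λ₁ λ₂)³ P_{k-7}(f))`. -/
def faceFormS (i : Fin 4) : LinearMap.BilinForm ℝ (Matrix (Fin 2) (Fin 2) (Poly 2)) :=
  let P := orthProj (l2Mat (facePts F i) 2) (faceHess F k i)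
  (l2Mat (facePts F i) 2).compl₁₂ P P + (l2Vec (facePts F i) 2).compl₁₂ rotRow rotRow

/-- `(𝒫 v, 𝒫 w)_f + (rot_f v, rot_f w)_f`, with `𝒫` the `L²(f)`-projection onto
`grad_f ((λ₀ λ₁ λ₂)² P_{k-5}(f))`. -/
def faceFormV (i : Fin 4) : LinearMap.BilinForm ℝ (Fin 2 → Poly 2) :=
  let P := orthProj (l2Vec (facePts F i) 2) (faceGrad F k i)
  (l2Vec (facePts F i) 2).compl₁₂ P P + (l2 (facePts F i)).compl₁₂ rot rot

variable (K) in
/-- `(𝒫 s, 𝒫 t)_K + (curl s, curl t)_K`, with `𝒫` the `L²(K)`-projection onto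
`hess ((λ₀ λ₁ λ₂ λ₃)² P_{k-6}(K))`. -/
def cellForm : LinearMap.BilinForm ℝ (Matrix (Fin 3) (Fin 3) (Poly 3)) :=
  let P := orthProj (l2Mat K 3) (cellHess K k)
  (l2Mat K 3).compl₁₂ P P + (l2Mat K 3).compl₁₂ curlRow curlRow

/-! ### The degrees of freedom -/

/-- The tangential-tangential component of `σ` on the face `i`, a `2 × 2` matrix field. -/
def faceTT (i : Fin 4) :
    Matrix (Fin 3) (Fin 3) (Poly 3) →ₗ[ℝ] Matrix (Fin 2) (Fin 2) (Poly 2) where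
  toFun s := Matrix.of fun a b => faceRestr F i (comp (F.tF i a) (F.tF i b) s)
  map_add' s t := by ext1 a b; simp
  map_smul' c s := by ext1 a b; simp

/-- The tangential components of `σ n` on the face `i`, a planar vector field. -/
def faceTN (i : Fin 4) : Matrix (Fin 3) (Fin 3) (Poly 3) →ₗ[ℝ] (Fin 2 → Poly 2) :=
  LinearMap.pi fun a => (faceRestr F i).toLinearMap ∘ₗ comp (F.tF i a) (F.n i)

/-- The moments `p ↦ (aᵀ σ b, p)_e` on the edge `e` against the test functions `p ∈ W`. -/
def edgeMoment (a b : Fin 3 → ℝ) (e : Edge) (W : Submodule ℝ (Poly 1)) :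
    Matrix (Fin 3) (Fin 3) (Poly 3) →ₗ[ℝ] Module.Dual ℝ W :=
  ((l2 (edgePts F e)) ∘ₗ (edgeRestr F e).toLinearMap ∘ₗ comp a b).domRestrict₂ W

/-- Componentwise restriction of a vector field to the edge `e`. -/
def edgeRestrV (e : Edge) : (Fin 3 → Poly 3) →ₗ[ℝ] (Fin 3 → Poly 1) :=
  LinearMap.pi fun i => (edgeRestr F e).toLinearMap ∘ₗ LinearMap.proj i

/-- The vector field `σ b`. -/
def mulVecC (b : Fin 3 → ℝ) : Matrix (Fin 3) (Fin 3) (Poly 3) →ₗ[ℝ] (Fin 3 → Poly 3) :=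
  LinearMap.pi fun i => comp (Pi.single i 1) b

/-- (a) The moments `w ↦ (σ t, w)_e`, `w ∈ RT`. -/
def dofA : Matrix (Fin 3) (Fin 3) (Poly 3) →ₗ[ℝ] (Edge → Module.Dual ℝ RT) :=
  LinearMap.pi fun e =>
    ((l2Vec (edgePts F e) 3).compl₁₂ (edgeRestrV F e ∘ₗ mulVecC (F.t e))
      (edgeRestrV F e)).domRestrict₂ RT

/-- Multi-indices `α` with `|α| ≤ 2`. -/
abbrev MIdx : Type := {a : Fin 3 → Fin 3 // ∑ i, (a i : ℕ) ≤ 2}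

variable (K) in
/-- (b) The values `D^α σ(x)`, `|α| ≤ 2`, at the vertices. -/
def dofB : PkS k →ₗ[ℝ] (Fin 4 → MIdx → Sym3) where
  toFun s := fun j a =>
    ⟨Matrix.of fun i l => eval (K j) (mpd (fun m => (a.1 m : ℕ)) (s.1 i l)),
      by
        refine ⟨?_, fun _ _ => Submodule.mem_top⟩
        ext i l
        simp only [Matrix.transpose_apply, Matrix.of_apply]
        rw [s.2.1.apply i l]⟩
  map_add' s t := by
    funext j a
    apply Subtype.ext
    ext i l
    simp
  map_smul' c s := by
    funext j a
    apply Subtype.ext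
    ext i l
    simp

/-- (c) The moments `p ↦ (tᵀ σ t, p)_e`, `p ∈ (λ₀ λ₁)³ P_{k-6}(e) / P₁(e)`. -/
def dofC : Matrix (Fin 3) (Fin 3) (Poly 3) →ₗ[ℝ]
    ((e : Edge) → Module.Dual ℝ (edgeSpaceMod F k 1 e)) :=
  LinearMap.pi fun e => edgeMoment F (F.t e) (F.t e) e _

/-- (d) The moments `p ↦ (n_jᵀ σ t, p)_e`, `p ∈ (λ₀ λ₁)³ P_{k-6}(e) / P₀(e)`, `j = 1, 2`. -/
def dofD : Matrix (Fin 3) (Fin 3) (Poly 3) →ₗ[ℝ]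
    ((e : Edge) → Fin 2 → Module.Dual ℝ (edgeSpaceMod F k 0 e)) :=
  LinearMap.pi fun e => LinearMap.pi fun j => edgeMoment F (F.nE e j) (F.t e) e _

/-- The unordered pairs `(j, j')` of indices of edge normals, listed with `j ≤ j'`. -/
abbrev NPair : Type := {p : Fin 2 × Fin 2 // p.1 ≤ p.2}

/-- (e) The moments `p ↦ (n_jᵀ σ n_j', p)_e`, `p ∈ (λ₀ λ₁)³ P_{k-6}(e)`. Since `σ` is symmetric,
the moments for `(j, j')` and `(j', j)` coincide and are counted once. -/
def dofE : Matrix (Fin 3) (Fin 3) (Poly 3) →ₗ[ℝ]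
    ((e : Edge) → NPair → Module.Dual ℝ (edgeSpace F k e)) :=
  LinearMap.pi fun e => LinearMap.pi fun p =>
    edgeMoment F (F.nE e p.1.1) (F.nE e p.1.2) e _

/-- (f) The moments of the face tangential-tangential components under `faceFormS`. -/
def dofF : Matrix (Fin 3) (Fin 3) (Poly 3) →ₗ[ℝ]
    ((i : Fin 4) → Module.Dual ℝ (faceSpaceS F k i)) :=
  LinearMap.pi fun i => (faceFormS F k i ∘ₗ faceTT F i).domRestrict₂ (faceSpaceS F k i)

/-- (g) The moments of the face normal-tangential components under `faceFormV`. -/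
def dofG : Matrix (Fin 3) (Fin 3) (Poly 3) →ₗ[ℝ]
    ((i : Fin 4) → Module.Dual ℝ (faceSpaceV F k i)) :=
  LinearMap.pi fun i => (faceFormV F k i ∘ₗ faceTN F i).domRestrict₂ (faceSpaceV F k i)

/-- (h) The moments in the cell under `cellForm`. -/
def dofH : Matrix (Fin 3) (Fin 3) (Poly 3) →ₗ[ℝ] Module.Dual ℝ (cellSpace F k) :=
  (cellForm K k).domRestrict₂ (cellSpace F k)

/-- The space of values of all the degrees of freedom (a)-(h). A family of moments against a test
space `W` takes its values in the dual of `W`, and so counts as `dim W` scalar degrees of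
freedom, one for each element of a basis of `W`. -/
abbrev DofSpace : Type :=
  (Edge → Module.Dual ℝ RT) × (Fin 4 → MIdx → Sym3) ×
  ((e : Edge) → Module.Dual ℝ (edgeSpaceMod F k 1 e)) ×
  ((e : Edge) → Fin 2 → Module.Dual ℝ (edgeSpaceMod F k 0 e)) ×
  ((e : Edge) → NPair → Module.Dual ℝ (edgeSpace F k e)) ×
  ((i : Fin 4) → Module.Dual ℝ (faceSpaceS F k i)) ×
  ((i : Fin 4) → Module.Dual ℝ (faceSpaceV F k i)) ×
  Module.Dual ℝ (cellSpace F k)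

/-- All the degrees of freedom (a)-(h) of `σ ∈ P_k(K; 𝕊)`. -/
def dof : PkS k →ₗ[ℝ] DofSpace F k :=
  let ι := (PkS k).subtype
  (dofA F ∘ₗ ι).prod <| (dofB K k).prod <| (dofC F k ∘ₗ ι).prod <| (dofD F k ∘ₗ ι).prod <|
    (dofE F k ∘ₗ ι).prod <| (dofF F k ∘ₗ ι).prod <| (dofG F k ∘ₗ ι).prod <| dofH F k ∘ₗ ι

end

end HuCurl

open MvPolynomial MeasureTheory

namespace HuCurl

noncomputable section

/-! ### Polynomials of bounded degree -/

/-! Unisolvence follows from injectivity of `dof` together with an upper bound on the dimension of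
the space of values.

Injectivity (`dof_injective`) descends from vertices to edges, faces and the cell. At each stage the
remaining part of σ lies in the test space of the next moments, so it may be tested against itself.
If all degrees of freedom vanish, the 2-jets at the vertices are zero. Hence on each edge every
component of σ is `(λ₀λ₁)³` times a polynomial of degree at most `k-6`. The Raviart-Thomas moments
make `nᵀσt` orthogonal to constants and `tᵀσt` orthogonal to affine functions, so the edge moments
(c)-(e) are L² norms and σ vanishes on the lines of the edges (`edgeRestr_comp_eq_zero`).

On a face each component is then divisible by `λ₀λ₁λ₂`, and the quotient vanishes at the vertices
because the second derivatives do (`faceRestr_comp_mem_faceSpace`). Definiteness of the two face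
forms kills the tangential-tangential and tangential-normal parts. What is left on a face is a
multiple of `n nᵀ`. Extending these four multiples into the cell and subtracting them leaves a field
that vanishes on all faces, hence a multiple of the cell bubble. So σ lies in the cell bubble space
(`mem_cellSpace`), and definiteness of the cell form gives zero.

For the dimensions, only upper bounds are proved for the test spaces. They add up exactly to `dim
P_k(K; 𝕊)` (`finrank_DofSpace_le`), and injectivity supplies the reverse inequality. The two
delicate bounds are those for the edge spaces orthogonal to `P_m` (`finrank_edgeSpaceMod_add_le`)
and for the cell bubble space, whose non-direct sum is controlled by its face traces
(`cellSpace_le`).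

All divisibility statements rest on one fact: an affine polynomial divides every polynomial that
vanishes on its zero hyperplane (`aff_dvd_iff`). -/

lemma mem_Pk {d m : ℕ} {p : Poly d} : p ∈ Pk d m ↔ p.totalDegree ≤ m :=
  mem_restrictTotalDegree _ _ _

instance (d m : ℕ) : FiniteDimensional ℝ (Pk d m) := by unfold Pk; infer_instance

lemma Pk_mono {d m n : ℕ} (h : m ≤ n) : Pk d m ≤ Pk d n := fun _ hp =>
  mem_Pk.2 ((mem_Pk.1 hp).trans h)

lemma mul_mem_Pk {d m n : ℕ} {p q : Poly d} (hp : p ∈ Pk d m) (hq : q ∈ Pk d n) :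
    p * q ∈ Pk d (m + n) :=
  mem_Pk.2 ((totalDegree_mul p q).trans (add_le_add (mem_Pk.1 hp) (mem_Pk.1 hq)))

lemma C_mem_Pk {d m : ℕ} (c : ℝ) : (C c : Poly d) ∈ Pk d m := mem_Pk.2 (by simp)

lemma X_mem_Pk {d m : ℕ} (i : Fin d) : (X i : Poly d) ∈ Pk d (m + 1) := mem_Pk.2 (by simp)

lemma finrank_Pk (d m : ℕ) : Module.finrank ℝ (Pk d m) = (d + m).choose m := by
  classical
  have hb := basisRestrictSupport ℝ {n : Fin d →₀ ℕ | (n.sum fun _ e => e) ≤ m}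
  have h1 : Module.finrank ℝ (Pk d m) =
      Nat.card {n : Fin d →₀ ℕ | (n.sum fun _ e => e) ≤ m} :=
    Module.finrank_eq_nat_card_basis hb
  have h2 : {n : Fin d →₀ ℕ | (n.sum fun _ e => e) ≤ m} =
      ((Finset.range (m + 1)).biUnion fun j => Finset.finsuppAntidiag (Finset.univ : Finset (Fin d)) j :
        Finset (Fin d →₀ ℕ)) := by
    ext n
    simp [Finsupp.sum_fintype]
  rw [h1, h2, Nat.card_coe_set_eq, Set.ncard_coe_finset, Finset.card_biUnion]
  · simp only [Finset.card_finsuppAntidiag_nat_eq_multichoose, Finset.card_univ, Fintype.card_fin]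
    induction m with
    | zero => simp
    | succ m ih =>
      -- Pascal's rule sums the monomial counts by degree. The facts `hb`, `h1`, `h2` depend on `m`,
      -- so they have become premises of `ih` and are supplied again here.
      rw [Finset.sum_range_succ, ih (basisRestrictSupport ℝ _) (Module.finrank_eq_nat_card_basis
        (basisRestrictSupport ℝ _)), Nat.multichoose_eq, ← add_assoc, Nat.add_sub_cancel,
        Nat.choose_succ_succ]
      ext n
      simp [Finsupp.sum_fintype]
  · intro i _ j _ hij
    refine Finset.disjoint_left.2 fun n hi hj => hij ?_
    rw [Finset.mem_finsuppAntidiag] at hi hj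
    exact hi.1.symm.trans hj.1

lemma aeval_mem_Pk {d e m : ℕ} {g : Fin d → Poly e} (hg : ∀ i, g i ∈ Pk e 1) {p : Poly d}
    (hp : p ∈ Pk d m) : aeval g p ∈ Pk e m := by
  rw [aeval_def, eval₂_eq]
  refine Submodule.sum_mem _ fun s hs => ?_
  rw [algebraMap_eq]
  refine mem_Pk.2 ((totalDegree_mul _ _).trans ?_)
  rw [totalDegree_C, zero_add]
  refine (totalDegree_finsetProd _ _).trans (le_trans ?_ (mem_Pk.1 hp))
  refine le_trans (Finset.sum_le_sum fun i _ => ?_) (le_totalDegree hs)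
  refine (totalDegree_pow _ _).trans ?_
  have := Nat.mul_le_mul_left (s i) (mem_Pk.1 (hg i))
  simpa using this

lemma eval_aeval {d e : ℕ} (g : Fin d → Poly e) (p : Poly d) (x : Fin e → ℝ) :
    eval x (aeval g p) = eval (fun i => eval x (g i)) p := by
  rw [← coe_aeval_eq_eval, ← coe_aeval_eq_eval, RingHom.coe_coe, RingHom.coe_coe, ← AlgHom.comp_apply,
    comp_aeval]

/-! ### Affine polynomials -/

/-- The affine polynomial `c + a ⬝ x`. -/
def aff {d : ℕ} (c : ℝ) (a : Fin d → ℝ) : Poly d := C c + ∑ l, C (a l) * X l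

@[simp] lemma eval_aff {d : ℕ} (c : ℝ) (a x : Fin d → ℝ) : eval x (aff c a) = c + a ⬝ᵥ x := by
  simp [aff, dotProduct]

lemma aff_mem_Pk {d : ℕ} (c : ℝ) (a : Fin d → ℝ) : aff c a ∈ Pk d 1 := by
  refine Submodule.add_mem _ (C_mem_Pk c) (Submodule.sum_mem _ fun l _ => ?_)
  simpa using mul_mem_Pk (C_mem_Pk (m := 0) (a l)) (X_mem_Pk (m := 0) l)

/-- A vector along which an affine polynomial has slope one. -/
lemma exists_dot_eq_one {d : ℕ} {a : Fin d → ℝ} (ha : a ≠ 0) : ∃ v, a ⬝ᵥ v = 1 := by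
  obtain ⟨i, hi⟩ := Function.ne_iff.1 ha
  exact ⟨Pi.single i (a i)⁻¹, by simpa using mul_inv_cancel₀ hi⟩

lemma aff_ne_zero {d : ℕ} {c : ℝ} {a : Fin d → ℝ} (ha : a ≠ 0) : aff c a ≠ 0 := by
  intro h
  obtain ⟨v, hv⟩ := exists_dot_eq_one ha
  have h1 := congrArg (eval v) h
  have h0 := congrArg (eval 0) h
  rw [eval_aff, hv, map_zero] at h1
  rw [eval_aff, dotProduct_zero, map_zero] at h0
  linarith

lemma totalDegree_aff {d : ℕ} {c : ℝ} {a : Fin d → ℝ} (ha : a ≠ 0) :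
    (aff c a).totalDegree = 1 := by
  refine le_antisymm (mem_Pk.1 (aff_mem_Pk c a)) (Nat.one_le_iff_ne_zero.2 fun h => ?_)
  rw [totalDegree_eq_zero_iff_eq_C] at h
  obtain ⟨v, hv⟩ := exists_dot_eq_one ha
  have h1 := congrArg (eval v) h
  have h0 := congrArg (eval 0) h
  rw [eval_aff, hv, eval_C] at h1
  rw [eval_aff, dotProduct_zero, eval_C] at h0
  linarith

/-- The projection along `v` onto the zero set of an affine polynomial, on polynomials. -/
def projAff {d : ℕ} (c : ℝ) (a v : Fin d → ℝ) : Poly d →ₐ[ℝ] Poly d :=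
  aeval fun i => X i - C (v i) * aff c a

lemma eval_projAff {d : ℕ} (c : ℝ) (a v x : Fin d → ℝ) (p : Poly d) :
    eval x (projAff c a v p) = eval (x - (c + a ⬝ᵥ x) • v) p := by
  rw [projAff, eval_aeval]
  congr 2
  funext i
  simp [mul_comm]

lemma projAff_eq_zero_iff {d : ℕ} {c : ℝ} {a v : Fin d → ℝ} (hv : a ⬝ᵥ v = 1) (p : Poly d) :
    projAff c a v p = 0 ↔ ∀ x, c + a ⬝ᵥ x = 0 → eval x p = 0 := by
  constructor
  · intro h x hx
    have := congrArg (eval x) h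
    simpa [eval_projAff, hx] using this
  · intro h
    refine MvPolynomial.funext fun x => ?_
    rw [eval_projAff, map_zero]
    refine h _ ?_
    rw [dotProduct_sub, dotProduct_smul, hv]
    simp

/-- Modulo the affine polynomial the substitution is the identity on each variable, hence on all
polynomials. -/
lemma aff_dvd_sub_projAff {d : ℕ} (c : ℝ) (a v : Fin d → ℝ) (p : Poly d) :
    aff c a ∣ p - projAff c a v p := by
  rw [← Ideal.mem_span_singleton, ← Ideal.Quotient.mk_eq_mk_iff_sub_mem]
  have : (Ideal.Quotient.mkₐ ℝ (Ideal.span {aff c a})) =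
      (Ideal.Quotient.mkₐ ℝ (Ideal.span {aff c a})).comp (projAff c a v) := by
    refine MvPolynomial.algHom_ext fun i => ?_
    simp only [AlgHom.comp_apply, projAff, aeval_X, Ideal.Quotient.mkₐ_eq_mk]
    rw [Ideal.Quotient.mk_eq_mk_iff_sub_mem, Ideal.mem_span_singleton]
    exact ⟨C (v i), by ring⟩
  exact DFunLike.congr_fun this p

lemma aff_dvd_iff {d : ℕ} {c : ℝ} {a : Fin d → ℝ} (ha : a ≠ 0) (p : Poly d) :
    aff c a ∣ p ↔ ∀ x, c + a ⬝ᵥ x = 0 → eval x p = 0 := by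
  constructor
  · rintro ⟨q, rfl⟩ x hx
    simp [hx]
  · intro h
    obtain ⟨v, hv⟩ := exists_dot_eq_one ha
    have := aff_dvd_sub_projAff c a v p
    rwa [(projAff_eq_zero_iff hv p).2 h, sub_zero] at this

/-- Its multiples are exactly the kernel of the algebra homomorphism `projAff`, whose target is a
domain. -/
lemma prime_aff {d : ℕ} {c : ℝ} {a : Fin d → ℝ} (ha : a ≠ 0) : Prime (aff c a) := by
  obtain ⟨v, hv⟩ := exists_dot_eq_one ha
  have key : ∀ p, aff c a ∣ p ↔ projAff c a v p = 0 := fun p => by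
    rw [aff_dvd_iff ha, projAff_eq_zero_iff hv]
  refine ⟨aff_ne_zero ha, fun h => ?_, fun p q h => ?_⟩
  · have h1 := (key 1).1 h.dvd
    simp at h1
  · simp only [key, map_mul, mul_eq_zero] at h ⊢
    exact h

/-! ### Dual families of affine polynomials -/

/-- The affine polynomials `aff (c j) (a j)` are dual to the points `y j`. -/
def IsDual {n d : ℕ} (y : Fin n → Fin d → ℝ) (c : Fin n → ℝ) (a : Fin n → Fin d → ℝ) : Prop :=
  ∀ j l, c j + a j ⬝ᵥ y l = if j = l then 1 else 0

namespace IsDual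

variable {n d : ℕ} {y : Fin n → Fin d → ℝ} {c : Fin n → ℝ} {a : Fin n → Fin d → ℝ}

lemma eval_aff (h : IsDual y c a) (j l : Fin n) :
    eval (y l) (aff (c j) (a j)) = if j = l then 1 else 0 := by
  rw [HuCurl.eval_aff, h j l]

lemma dot_sub (h : IsDual y c a) {j l : Fin n} (hjl : j ≠ l) : a j ⬝ᵥ (y j - y l) = 1 := by
  have h1 := h j j
  have h2 := h j l
  simp only [if_true, if_neg hjl] at h1 h2
  rw [dotProduct_sub]
  linarith

lemma ne_zero [Nontrivial (Fin n)] (h : IsDual y c a) (j : Fin n) : a j ≠ 0 := by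
  obtain ⟨l, hl⟩ := exists_ne j
  intro h0
  have := h.dot_sub hl.symm
  simp [h0] at this

/-- The point `y l` is a zero of the first polynomial but not of the second, and the first one is
irreducible. -/
lemma isRelPrime [Nontrivial (Fin n)] (h : IsDual y c a) {j l : Fin n} (hjl : j ≠ l) :
    IsRelPrime (aff (c j) (a j)) (aff (c l) (a l)) := by
  refine ((prime_aff (h.ne_zero j)).irreducible.isRelPrime_iff_not_dvd).2 fun hd => ?_
  have h1 := (aff_dvd_iff (h.ne_zero j) _).1 hd (y l) (by rw [h j l, if_neg hjl])
  rw [HuCurl.eval_aff, h l l] at h1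
  simp at h1

lemma prod_dvd [Nontrivial (Fin n)] (h : IsDual y c a) {p : Poly d}
    (hp : ∀ j x, c j + a j ⬝ᵥ x = 0 → eval x p = 0) : ∏ j, aff (c j) (a j) ∣ p :=
  Fintype.prod_dvd_of_isRelPrime (fun _ _ hjl => h.isRelPrime hjl) fun j =>
    (aff_dvd_iff (h.ne_zero j) p).2 (hp j)

lemma prod_ne_zero [Nontrivial (Fin n)] (h : IsDual y c a) : ∏ j, aff (c j) (a j) ≠ 0 :=
  Finset.prod_ne_zero_iff.2 fun j _ => aff_ne_zero (h.ne_zero j)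

end IsDual

lemma totalDegree_prod_aff {n d : ℕ} {c : Fin n → ℝ} {a : Fin n → Fin d → ℝ}
    (ha : ∀ j, a j ≠ 0) (s : Finset (Fin n)) :
    (∏ j ∈ s, aff (c j) (a j)).totalDegree = s.card := by
  classical
  induction s using Finset.induction_on with
  | empty => simp
  | insert j s hj ih =>
    rw [Finset.prod_insert hj, totalDegree_mul_of_isDomain (aff_ne_zero (ha j))
      (Finset.prod_ne_zero_iff.2 fun l _ => aff_ne_zero (ha l)), ih, totalDegree_aff (ha j),
      Finset.card_insert_of_notMem hj, add_comm]

lemma mem_Pk_of_mul {d m : ℕ} {p q : Poly d} (hp : p ≠ 0) (h : p * q ∈ Pk d m) :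
    q ∈ Pk d (m - p.totalDegree) := by
  rcases eq_or_ne q 0 with rfl | hq
  · exact Submodule.zero_mem _
  · rw [mem_Pk, totalDegree_mul_of_isDomain hp hq] at h
    exact mem_Pk.2 (by omega)

/-- The basic factorization on faces and on the cell: vanishing on all the facets splits off the
bubble and lowers the degree by the number of vertices. -/
lemma IsDual.exists_eq_mul {n d m : ℕ} [Nontrivial (Fin n)]
    {y : Fin n → Fin d → ℝ} {c : Fin n → ℝ}
    {a : Fin n → Fin d → ℝ} (h : IsDual y c a) {p : Poly d} (hm : p ∈ Pk d m)
    (hp : ∀ j x, c j + a j ⬝ᵥ x = 0 → eval x p = 0) :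
    ∃ q ∈ Pk d (m - n), p = (∏ j, aff (c j) (a j)) * q := by
  obtain ⟨q, rfl⟩ := h.prod_dvd hp
  refine ⟨q, ?_, rfl⟩
  have := mem_Pk_of_mul h.prod_ne_zero hm
  rwa [totalDegree_prod_aff h.ne_zero, Finset.card_univ, Fintype.card_fin] at this

/-! ### Restriction to affine subspaces -/

/-- The affine parametrization `s ↦ x₀ + ∑ s_m τ_m`. -/
def param {d : ℕ} (x₀ : Fin 3 → ℝ) (τ : Fin d → Fin 3 → ℝ) (s : Fin d → ℝ) : Fin 3 → ℝ :=
  x₀ + ∑ m, s m • τ m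

lemma param_apply {d : ℕ} (x₀ : Fin 3 → ℝ) (τ : Fin d → Fin 3 → ℝ) (s : Fin d → ℝ) (i : Fin 3) :
    param x₀ τ s i = x₀ i + ∑ m, τ m i * s m := by
  simp [param, mul_comm]

lemma eval_restr {d : ℕ} (x₀ : Fin 3 → ℝ) (τ : Fin d → Fin 3 → ℝ) (s : Fin d → ℝ) (p : Poly 3) :
    eval s (restr x₀ τ p) = eval (param x₀ τ s) p := by
  rw [restr, eval_aeval]
  congr 2
  funext i
  simp [param_apply]

lemma restr_X {d : ℕ} (x₀ : Fin 3 → ℝ) (τ : Fin d → Fin 3 → ℝ) (i : Fin 3) :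
    restr x₀ τ (X i) = aff (x₀ i) fun m => τ m i := by
  simp [restr, aff]

lemma restr_mem_Pk {d m : ℕ} (x₀ : Fin 3 → ℝ) (τ : Fin d → Fin 3 → ℝ) {p : Poly 3}
    (hp : p ∈ Pk 3 m) : restr x₀ τ p ∈ Pk d m :=
  aeval_mem_Pk (fun _ => aff_mem_Pk _ _) hp

lemma dot_param {d : ℕ} (a x₀ : Fin 3 → ℝ) (τ : Fin d → Fin 3 → ℝ) (s : Fin d → ℝ) :
    a ⬝ᵥ param x₀ τ s = a ⬝ᵥ x₀ + (fun m => a ⬝ᵥ τ m) ⬝ᵥ s := by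
  rw [param, dotProduct_add, dotProduct_sum]
  exact congrArg _ (Finset.sum_congr rfl fun m _ => by rw [dotProduct_smul, smul_eq_mul, mul_comm])

lemma restr_aff {d : ℕ} (x₀ : Fin 3 → ℝ) (τ : Fin d → Fin 3 → ℝ) (c : ℝ) (a : Fin 3 → ℝ) :
    restr x₀ τ (aff c a) = aff (c + a ⬝ᵥ x₀) fun m => a ⬝ᵥ τ m := by
  refine MvPolynomial.funext fun s => ?_
  rw [eval_restr, eval_aff, eval_aff, dot_param, add_assoc]

/-! ### Second order jets -/

/-- The polynomials all of whose derivatives of order at most two vanish at `x`. -/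
def jet2 {d : ℕ} (x : Fin d → ℝ) : Submodule ℝ (Poly d) where
  carrier := {p | eval x p = 0 ∧ (∀ l, eval x (pd l p) = 0) ∧ ∀ l m, eval x (pd l (pd m p)) = 0}
  add_mem' := fun ha hb => by
    refine ⟨?_, fun l => ?_, fun l m => ?_⟩
    · simp [ha.1, hb.1]
    · simp [ha.2.1, hb.2.1]
    · simp [ha.2.2, hb.2.2]
  zero_mem' := by simp
  smul_mem' := fun c p ha => by
    refine ⟨?_, fun l => ?_, fun l m => ?_⟩
    · simp [ha.1]
    · simp [ha.2.1]
    · simp [ha.2.2]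

lemma pd_C {d : ℕ} (i : Fin d) (c : ℝ) : pd i (C c : Poly d) = 0 := pderiv_C

lemma pd_X {d : ℕ} (i j : Fin d) : pd i (X j : Poly d) = if i = j then 1 else 0 := by
  classical
  change pderiv i (X j) = _
  rw [pderiv_X, Pi.single_apply]
  simp [eq_comm]

lemma pd_mul {d : ℕ} (i : Fin d) (p q : Poly d) : pd i (p * q) = p * pd i q + q * pd i p := by
  change pderiv i (p * q) = p * pderiv i q + q * pderiv i p
  rw [pderiv_mul]
  ring

lemma pd_comm {d : ℕ} (i j : Fin d) (p : Poly d) : pd i (pd j p) = pd j (pd i p) := by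
  induction p using MvPolynomial.induction_on with
  | C a => simp [pd_C]
  | add p q hp hq => simp [hp, hq]
  | mul_X p l hp =>
    simp only [pd_mul, pd_X, map_add, hp]
    have h1 : ∀ i, pd i (1 : Poly d) = 0 := fun i => pderiv_one
    split_ifs <;> simp only [h1, map_zero] <;> ring

lemma pd_aff {d : ℕ} (i : Fin d) (c : ℝ) (a : Fin d → ℝ) : pd i (aff c a) = C (a i) := by
  simp [aff, pd_C, pd_mul, pd_X]

lemma pd_restr {d : ℕ} (x₀ : Fin 3 → ℝ) (τ : Fin d → Fin 3 → ℝ) (m : Fin d) (p : Poly 3) :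
    pd m (restr x₀ τ p) = ∑ l, C (τ m l) * restr x₀ τ (pd l p) := by
  induction p using MvPolynomial.induction_on with
  | C a => simp [pd_C, restr]
  | add p q hp hq => simp [hp, hq, mul_add, Finset.sum_add_distrib]
  | mul_X p l hp =>
    rw [map_mul, pd_mul, hp, restr_X, pd_aff]
    simp only [pd_mul, map_add, map_mul, restr_X, pd_X, mul_add, Finset.sum_add_distrib]
    congr 1
    · simp [apply_ite (restr x₀ τ), mul_comm]
    · rw [Finset.mul_sum]
      exact Finset.sum_congr rfl fun i _ => by ring

/-- Chain rule: derivatives along the subspace are constant combinations of ambient derivatives of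
the same order. -/
lemma restr_mem_jet2 {d : ℕ} {x₀ : Fin 3 → ℝ} {τ : Fin d → Fin 3 → ℝ} {s : Fin d → ℝ}
    {p : Poly 3} (hp : p ∈ jet2 (param x₀ τ s)) : restr x₀ τ p ∈ jet2 s := by
  obtain ⟨h0, h1, h2⟩ := hp
  refine ⟨?_, fun l => ?_, fun l m => ?_⟩
  · rw [eval_restr, h0]
  · simp [pd_restr, eval_restr, h1]
  · simp [pd_restr, eval_restr, h2, pd_mul, pd_C]

/-- The derivative in the direction `v`. -/
def dirD {d : ℕ} (v : Fin d → ℝ) : Poly d →ₗ[ℝ] Poly d := ∑ m, v m • pd m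

lemma dirD_apply {d : ℕ} (v : Fin d → ℝ) (p : Poly d) : dirD v p = ∑ m, v m • pd m p := by
  simp [dirD]

lemma dirD_mul {d : ℕ} (v : Fin d → ℝ) (p q : Poly d) :
    dirD v (p * q) = p * dirD v q + q * dirD v p := by
  simp [dirD_apply, pd_mul, Finset.mul_sum, Finset.sum_add_distrib]

lemma dirD_aff {d : ℕ} (v : Fin d → ℝ) (c : ℝ) (a : Fin d → ℝ) :
    dirD v (aff c a) = C (a ⬝ᵥ v) := by
  simp [dirD_apply, pd_aff, dotProduct, MvPolynomial.smul_eq_C_mul, mul_comm]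

lemma dirD_C {d : ℕ} (v : Fin d → ℝ) (c : ℝ) : dirD v (C c) = 0 := by
  simp [dirD_apply, pd_C]

lemma eval_dirD {d : ℕ} {x : Fin d → ℝ} {p : Poly d} (hp : p ∈ jet2 x) (v : Fin d → ℝ) :
    eval x (dirD v p) = 0 := by
  simp [dirD_apply, hp.2.1]

lemma eval_dirD_dirD {d : ℕ} {x : Fin d → ℝ} {p : Poly d} (hp : p ∈ jet2 x) (v : Fin d → ℝ) :
    eval x (dirD v (dirD v p)) = 0 := by
  simp [dirD_apply, hp.2.2]

/-- At a common zero of two affine factors with slope one along `v`, the second derivative of the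
product along `v` is `2 r(x)`. -/
lemma eval_eq_zero_of_mul_mul_mem_jet2 {d : ℕ} {x v a b : Fin d → ℝ} {c c' : ℝ} {r : Poly d}
    (ha : c + a ⬝ᵥ x = 0) (hb : c' + b ⬝ᵥ x = 0) (hav : a ⬝ᵥ v = 1) (hbv : b ⬝ᵥ v = 1)
    (h : aff c a * aff c' b * r ∈ jet2 x) : eval x r = 0 := by
  have := eval_dirD_dirD h v
  simp only [dirD_mul, dirD_aff, dirD_C, map_add, map_mul, eval_aff, ha, hb, eval_C, hav, hbv,
    map_zero] at this
  linarith

lemma aff_pow_three_dvd {c : ℝ} {a y : Fin 1 → ℝ} (ha : a ≠ 0) (hy : c + a ⬝ᵥ y = 0)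
    {p : Poly 1} (hp : p ∈ jet2 y) : aff c a ^ 3 ∣ p := by
  obtain ⟨v, hv⟩ := exists_dot_eq_one ha
  have key : ∀ q : Poly 1, eval y q = 0 → ∃ r, q = aff c a * r := fun q hq => by
    refine (aff_dvd_iff ha q).2 fun x hx => ?_
    have h0 : a 0 ≠ 0 := fun h => ha (funext fun i => by rw [Subsingleton.elim i 0, h]; rfl)
    have : x = y := funext fun i => by
      rw [Subsingleton.elim i 0]
      simp only [dotProduct, Fin.sum_univ_one] at hx hy
      exact mul_left_cancel₀ h0 (by linarith)
    rw [this, hq]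
  obtain ⟨q, rfl⟩ := key p hp.1
  have h1 := eval_dirD hp v
  simp only [dirD_mul, dirD_aff, map_add, map_mul, eval_aff, hy, eval_C, hv] at h1
  obtain ⟨r, rfl⟩ := key q (by linarith)
  have h2 := eval_eq_zero_of_mul_mul_mem_jet2 hy hy hv hv (r := r) (by rwa [mul_assoc])
  obtain ⟨t, rfl⟩ := key r h2
  exact ⟨t, by ring⟩

lemma IsDual.exists_eq_cube_mul {m : ℕ} {y : Fin 2 → Fin 1 → ℝ} {c : Fin 2 → ℝ}
    {a : Fin 2 → Fin 1 → ℝ} (h : IsDual y c a) {p : Poly 1} (hm : p ∈ Pk 1 m)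
    (hp : ∀ j, p ∈ jet2 (y j)) :
    ∃ q ∈ Pk 1 (m - 6), p = (∏ j, aff (c j) (a j)) ^ 3 * q := by
  have hd : (∏ j, aff (c j) (a j)) ^ 3 ∣ p := by
    rw [← Finset.prod_pow]
    refine Fintype.prod_dvd_of_isRelPrime (fun j l hjl => (h.isRelPrime hjl).pow) fun j => ?_
    -- On a segment the coordinate `j` has its zero at the other endpoint, `1 - j`.
    have hj : j ≠ 1 - j := by fin_cases j <;> decide
    exact aff_pow_three_dvd (h.ne_zero j) (by rw [h j (1 - j), if_neg hj]) (hp (1 - j))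
  obtain ⟨q, rfl⟩ := hd
  refine ⟨q, ?_, rfl⟩
  have := mem_Pk_of_mul (pow_ne_zero 3 h.prod_ne_zero) hm
  rw [pow_succ, pow_two, totalDegree_mul_of_isDomain (mul_ne_zero h.prod_ne_zero h.prod_ne_zero)
    h.prod_ne_zero, totalDegree_mul_of_isDomain h.prod_ne_zero h.prod_ne_zero,
    totalDegree_prod_aff h.ne_zero] at this
  exact this

/-! ### Barycentric coordinates -/

section Barycentric

variable (K : Tet)

/-- The gradient of a barycentric coordinate. -/
def baryGrad (i : Fin 4) : Fin 3 → ℝ := fun l => (K.coord i).linear (Pi.single l 1)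

lemma bary_eq_aff (i : Fin 4) : bary K i = aff (K.coord i 0) (baryGrad K i) := rfl

lemma baryGrad_dot (i : Fin 4) (v : Fin 3 → ℝ) : baryGrad K i ⬝ᵥ v = (K.coord i).linear v := by
  conv_rhs => rw [pi_eq_sum_univ' v]
  simp [baryGrad, dotProduct, mul_comm, Pi.single]

lemma coord_eq (i : Fin 4) (x : Fin 3 → ℝ) :
    K.coord i 0 + baryGrad K i ⬝ᵥ x = K.coord i x := by
  rw [baryGrad_dot]
  have := (K.coord i).map_vadd 0 x
  simp only [vadd_eq_add, add_zero] at this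
  rw [this, add_comm]

lemma eval_bary (i : Fin 4) (x : Fin 3 → ℝ) : eval x (bary K i) = K.coord i x := by
  rw [bary_eq_aff, eval_aff, coord_eq]

lemma isDual_bary : IsDual K (fun i => K.coord i 0) (baryGrad K) := fun j l => by
  rw [coord_eq, AffineBasis.coord_apply]

lemma sum_coord_smul (x : Fin 3 → ℝ) : ∑ i, K.coord i x • K i = x :=
  K.linear_combination_coord_eq_self x

end Barycentric

/-! ### Orthonormal frames of `ℝ³` -/

lemma eval_comp (a b : Fin 3 → ℝ) (s : Matrix (Fin 3) (Fin 3) (Poly 3)) (x : Fin 3 → ℝ) :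
    eval x (comp a b s) = a ⬝ᵥ (s.map (eval x)).mulVec b := by
  simp [comp, Matrix.mulVec, dotProduct, Finset.mul_sum, mul_assoc, mul_comm]

lemma comp_mem {W : Submodule ℝ (Poly 3)} {s : Matrix (Fin 3) (Fin 3) (Poly 3)}
    (hs : ∀ i j, s i j ∈ W) (a b : Fin 3 → ℝ) : comp a b s ∈ W := by
  simp only [comp, LinearMap.sum_apply, LinearMap.smul_apply, Matrix.entryLinearMap_apply]
  exact Submodule.sum_mem _ fun i _ => Submodule.sum_mem _ fun j _ => W.smul_mem _ (hs i j)

lemma comp_symm {s : Matrix (Fin 3) (Fin 3) (Poly 3)} (hs : s.IsSymm) (a b : Fin 3 → ℝ) :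
    comp a b s = comp b a s := by
  simp only [comp, LinearMap.sum_apply, LinearMap.smul_apply, Matrix.entryLinearMap_apply]
  rw [Finset.sum_comm]
  refine Finset.sum_congr rfl fun i _ => Finset.sum_congr rfl fun j _ => ?_
  rw [hs.apply, mul_comm]

/-- Orthonormal bases of `ℝ³`. -/
def IsONFrame (f : Fin 3 → Fin 3 → ℝ) : Prop := ∀ a b, f a ⬝ᵥ f b = if a = b then 1 else 0

namespace IsONFrame

variable {f : Fin 3 → Fin 3 → ℝ}

lemma transpose_mul (hf : IsONFrame f) : (Matrix.of f).transpose * Matrix.of f = 1 := by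
  refine mul_eq_one_comm.1 ?_
  ext a b
  simpa [Matrix.mul_apply, Matrix.one_apply, dotProduct] using hf a b

lemma sum_dot_smul (hf : IsONFrame f) (v : Fin 3 → ℝ) : ∑ a, (f a ⬝ᵥ v) • f a = v := by
  have h := congrArg (fun M => M.mulVec v) hf.transpose_mul
  simp only [← Matrix.mulVec_mulVec, Matrix.one_mulVec] at h
  conv_rhs => rw [← h]
  funext i
  simp [Matrix.mulVec, dotProduct, Finset.sum_apply, mul_comm]

lemma matrix_eq (hf : IsONFrame f) {M N : Matrix (Fin 3) (Fin 3) ℝ}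
    (h : ∀ a b, f a ⬝ᵥ M.mulVec (f b) = f a ⬝ᵥ N.mulVec (f b)) : M = N := by
  have key : ∀ M : Matrix (Fin 3) (Fin 3) ℝ, ∀ a b,
      (Matrix.of f * M * (Matrix.of f).transpose) a b = f a ⬝ᵥ M.mulVec (f b) := fun M a b => by
    rw [Matrix.mul_assoc]
    simp [Matrix.mul_apply, Matrix.mulVec, dotProduct]
  have h1 : Matrix.of f * M * (Matrix.of f).transpose =
      Matrix.of f * N * (Matrix.of f).transpose := by
    ext a b
    rw [key, key, h]
  have h2 := congrArg (fun A => (Matrix.of f).transpose * A * Matrix.of f) h1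
  have key' : ∀ M : Matrix (Fin 3) (Fin 3) ℝ, (Matrix.of f).transpose *
      (Matrix.of f * M * (Matrix.of f).transpose) * Matrix.of f = M := fun M => by
    rw [show (Matrix.of f).transpose * (Matrix.of f * M * (Matrix.of f).transpose) * Matrix.of f =
      ((Matrix.of f).transpose * Matrix.of f) * M * ((Matrix.of f).transpose * Matrix.of f) by
      simp only [Matrix.mul_assoc], hf.transpose_mul, one_mul, mul_one]
  simpa only [key'] using h2

end IsONFrame

section Geometry

variable {K : Tet} (F : Frame K)

/-- The orthonormal frame of an edge. -/
def edgeFrame (e : Edge) : Fin 3 → Fin 3 → ℝ := ![F.t e, F.nE e 0, F.nE e 1]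

/-- The orthonormal frame of a face. -/
def faceFrame (i : Fin 4) : Fin 3 → Fin 3 → ℝ := ![F.tF i 0, F.tF i 1, F.n i]

lemma isONFrame_edgeFrame (e : Edge) : IsONFrame (edgeFrame F e) := by
  intro a b
  have h := F.nE_orthonormal e
  have h' : ∀ a, F.t e ⬝ᵥ F.nE e a = 0 := fun a => by rw [dotProduct_comm, F.nE_normal]
  fin_cases a <;> fin_cases b <;> simp [edgeFrame, h, h', F.t_unit, F.nE_normal]

lemma isONFrame_faceFrame (i : Fin 4) : IsONFrame (faceFrame F i) := by
  intro a b
  have h := F.tF_orthonormal i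
  have h' : ∀ a, F.n i ⬝ᵥ F.tF i a = 0 := fun a => by rw [dotProduct_comm, F.tF_tangent]
  fin_cases a <;> fin_cases b <;> simp [faceFrame, h, h', F.n_unit, F.tF_tangent]

/-! ### Geometry of edges and faces -/

lemma baryGrad_dot_eq_sub (l : Fin 4) (v : Fin 3 → ℝ) :
    baryGrad K l ⬝ᵥ v = K.coord l v - K.coord l 0 :=
  eq_sub_of_add_eq' (coord_eq K l v)

lemma sum_baryGrad_dot_smul (v : Fin 3 → ℝ) : ∑ l, (baryGrad K l ⬝ᵥ v) • K l = v := by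
  simp only [baryGrad_dot_eq_sub, sub_smul, Finset.sum_sub_distrib, sum_coord_smul, sub_zero]

lemma sum_baryGrad_dot (v : Fin 3 → ℝ) : ∑ l, baryGrad K l ⬝ᵥ v = 0 := by
  simp only [baryGrad_dot_eq_sub, Finset.sum_sub_distrib, K.sum_coord_apply_eq_one, sub_self]

/-- The face normal is parallel to the gradient of `λ_i`: in the expansion of `v` along the vertices
with coefficients `∇λ_l ⬝ v`, which sum to zero, only the vertex off the face contributes to the
normal component. -/
lemma n_dot (i : Fin 4) (v : Fin 3 → ℝ) :
    F.n i ⬝ᵥ v = baryGrad K i ⬝ᵥ v * F.n i ⬝ᵥ (K i - faceVert K i 0) := by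
  have h : F.n i ⬝ᵥ v = ∑ l, (baryGrad K l ⬝ᵥ v) * F.n i ⬝ᵥ (K l - faceVert K i 0) := by
    simp only [dotProduct_sub, mul_sub, Finset.sum_sub_distrib, ← Finset.sum_mul,
      sum_baryGrad_dot, zero_mul, sub_zero]
    conv_lhs => rw [← sum_baryGrad_dot_smul (K := K) v, dotProduct_sum]
    simp only [dotProduct_smul, smul_eq_mul]
  rw [h]
  refine Finset.sum_eq_single i (fun l _ hl => ?_) (by simp)
  rw [faceVert, F.n_normal i l _ hl (Fin.succAbove_ne i 0), mul_zero]

lemma n_dot_ne_zero (i : Fin 4) : F.n i ⬝ᵥ (K i - faceVert K i 0) ≠ 0 := fun h => by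
  have := n_dot F i (F.n i)
  rw [h, F.n_unit, mul_zero] at this
  exact one_ne_zero this

lemma baryGrad_dot_tF (i : Fin 4) (m : Fin 2) : baryGrad K i ⬝ᵥ F.tF i m = 0 := by
  have := n_dot F i (F.tF i m)
  rw [dotProduct_comm, F.tF_tangent] at this
  exact (mul_eq_zero.1 this.symm).resolve_right (n_dot_ne_zero F i)

/-- The parametrization of the plane of a face. -/
abbrev facePar (i : Fin 4) : (Fin 2 → ℝ) → Fin 3 → ℝ := param (faceVert K i 0) (F.tF i)

/-- The parametrization of the line of an edge. -/
abbrev edgePar (e : Edge) : (Fin 1 → ℝ) → Fin 3 → ℝ :=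
  param (edgeVert K e 0) fun _ => F.t e

lemma coord_facePar (i : Fin 4) (s : Fin 2 → ℝ) : K.coord i (facePar F i s) = 0 := by
  rw [← coord_eq, dot_param, ← add_assoc, coord_eq]
  have h : (fun m => baryGrad K i ⬝ᵥ F.tF i m) = 0 := funext (baryGrad_dot_tF F i)
  simp [h, faceVert, Fin.ne_succAbove]

/-- This covers the whole plane of the face, not only the triangle, as the divisibility arguments
require. -/
lemma facePar_of_coord_eq_zero {i : Fin 4} {x : Fin 3 → ℝ} (hx : K.coord i x = 0) :
    facePar F i (fun m => (x - faceVert K i 0) ⬝ᵥ F.tF i m) = x := by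
  have h0 : F.n i ⬝ᵥ (x - faceVert K i 0) = 0 := by
    have h1 : K.coord i (faceVert K i 0) = 0 := by
      simp [faceVert, Fin.ne_succAbove]
    rw [← coord_eq] at hx h1
    rw [n_dot, dotProduct_sub, show baryGrad K i ⬝ᵥ x - baryGrad K i ⬝ᵥ faceVert K i 0 = 0 by
      linarith, zero_mul]
  have h := (isONFrame_faceFrame F i).sum_dot_smul (x - faceVert K i 0)
  simp only [faceFrame, Fin.sum_univ_three, Matrix.cons_val_zero, Matrix.cons_val_one,
    Matrix.cons_val, h0, zero_smul, add_zero] at h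
  simp only [facePar, param, Fin.sum_univ_two, dotProduct_comm _ (F.tF i _)]
  rw [h]
  abel

lemma facePar_facePts (i : Fin 4) (j : Fin 3) :
    facePar F i (facePts F i j) = K (i.succAbove j) :=
  facePar_of_coord_eq_zero F (x := K (i.succAbove j))
    (by simp [Fin.ne_succAbove])

lemma edgePar_edgePts (e : Edge) (j : Fin 2) :
    edgePar F e (edgePts F e j) = K (![e.1.1, e.1.2] j) := by
  obtain ⟨c, hc⟩ := F.t_tangent e
  simp only [edgePar, param, edgePts, localPts, Finset.univ_unique, Finset.sum_singleton]
  fin_cases j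
  · simp [edgeVert]
  · simp [edgeVert, hc, F.t_unit]
    rw [← hc]
    abel

/-- Restricted barycentric coordinates stay dual to the vertices of the subsimplex, so edges and
faces share the same factorization lemmas. -/
lemma isDual_restr {n d : ℕ} {x₀ : Fin 3 → ℝ} {τ : Fin d → Fin 3 → ℝ} {y : Fin n → Fin d → ℝ}
    {idx : Fin n → Fin 4} (hidx : Function.Injective idx)
    (hy : ∀ l, param x₀ τ (y l) = K (idx l)) :
    IsDual y (fun j => K.coord (idx j) 0 + baryGrad K (idx j) ⬝ᵥ x₀)
      (fun j m => baryGrad K (idx j) ⬝ᵥ τ m) := fun j l => by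
  rw [add_assoc, ← dot_param, coord_eq, hy, AffineBasis.coord_apply]
  simp [hidx.eq_iff]

lemma isDual_face (i : Fin 4) :
    IsDual (facePts F i) (fun j => K.coord (i.succAbove j) 0 +
      baryGrad K (i.succAbove j) ⬝ᵥ faceVert K i 0)
      (fun j m => baryGrad K (i.succAbove j) ⬝ᵥ F.tF i m) :=
  isDual_restr Fin.succAbove_right_injective (facePar_facePts F i)

lemma isDual_edge (e : Edge) :
    IsDual (edgePts F e) (fun j => K.coord (![e.1.1, e.1.2] j) 0 +
      baryGrad K (![e.1.1, e.1.2] j) ⬝ᵥ edgeVert K e 0)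
      (fun j _ => baryGrad K (![e.1.1, e.1.2] j) ⬝ᵥ F.t e) := by
  refine isDual_restr ?_ (edgePar_edgePts F e)
  have := e.2.ne
  intro a b
  fin_cases a <;> fin_cases b <;> simp [this, this.symm]

lemma faceRestr_bary (i : Fin 4) (j : Fin 4) : faceRestr F i (bary K j) =
    aff (K.coord j 0 + baryGrad K j ⬝ᵥ faceVert K i 0) fun m => baryGrad K j ⬝ᵥ F.tF i m :=
  restr_aff _ _ _ _

lemma edgeRestr_bary (e : Edge) (j : Fin 4) : edgeRestr F e (bary K j) =
    aff (K.coord j 0 + baryGrad K j ⬝ᵥ edgeVert K e 0) fun _ => baryGrad K j ⬝ᵥ F.t e :=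
  restr_aff _ _ _ _

lemma faceBub_eq (i : Fin 4) : faceBub F i = ∏ j : Fin 3, aff (K.coord (i.succAbove j) 0 +
    baryGrad K (i.succAbove j) ⬝ᵥ faceVert K i 0)
    (fun m => baryGrad K (i.succAbove j) ⬝ᵥ F.tF i m) := by
  rw [faceBub, map_prod]
  exact Finset.prod_congr rfl fun j _ => faceRestr_bary F i _

lemma edgeBub_eq (e : Edge) : edgeBub F e = ∏ j : Fin 2, aff (K.coord (![e.1.1, e.1.2] j) 0 +
      baryGrad K (![e.1.1, e.1.2] j) ⬝ᵥ edgeVert K e 0)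
      (fun _ => baryGrad K (![e.1.1, e.1.2] j) ⬝ᵥ F.t e) := by
  rw [edgeBub, map_mul, edgeRestr_bary, edgeRestr_bary, Fin.prod_univ_two]
  rfl

lemma eval_faceRestr (i : Fin 4) (s : Fin 2 → ℝ) (p : Poly 3) :
    eval s (faceRestr F i p) = eval (facePar F i s) p := eval_restr _ _ _ _

lemma eval_edgeRestr (e : Edge) (s : Fin 1 → ℝ) (p : Poly 3) :
    eval s (edgeRestr F e p) = eval (edgePar F e s) p := eval_restr _ _ _ _

end Geometry

/-! ### Definiteness on edges -/

lemma l2_apply {n d : ℕ} (v : Fin n → Fin d → ℝ) (p q : Poly d) :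
    l2 v p q = simplexInt v (p * q) := rfl

lemma l2Vec_apply {n d m : ℕ} (v : Fin n → Fin d → ℝ) (p q : Fin m → Poly d) :
    l2Vec v m p q = ∑ i, l2 v (p i) (q i) := by
  simp [l2Vec]

lemma mem_mulBy {d : ℕ} {b p : Poly d} {W : Submodule ℝ (Poly d)} :
    p ∈ mulBy b W ↔ ∃ q ∈ W, p = b * q := by
  simp only [mulBy, Submodule.mem_map, LinearMap.mulLeft_apply, eq_comm]

/-- A polynomial in one variable which vanishes on a nonempty open set is zero. -/
lemma eq_zero_of_eqOn_isOpen {U : Set (Fin 1 → ℝ)} (hU : IsOpen U) (hne : U.Nonempty) {g : Poly 1}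
    (h : ∀ x ∈ U, eval x g = 0) : g = 0 := by
  obtain ⟨x, hx⟩ := hne
  have hc : Continuous fun (r : ℝ) (_ : Fin 1) => r := by fun_prop
  have hx' : (fun _ => x 0) = x := funext fun i => by rw [Subsingleton.elim i 0]
  refine funext_set (fun _ => (fun (r : ℝ) (_ : Fin 1) => r) ⁻¹' U) (fun _ => ?_) fun y hy => ?_
  · exact infinite_of_mem_nhds (x 0) ((hU.preimage hc).mem_nhds (by simpa [hx'] using hx))
  · have hy' : (fun _ => y 0) = y := funext fun i => by rw [Subsingleton.elim i 0]
    have h0 : (fun _ => y 0) ∈ U := hy 0 trivial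
    rw [map_zero, h y (hy' ▸ h0)]

namespace IsDual

variable {y : Fin 2 → Fin 1 → ℝ} {c : Fin 2 → ℝ} {a : Fin 2 → Fin 1 → ℝ}

lemma nonneg_of_mem_simplexSet (h : IsDual y c a) {x : Fin 1 → ℝ} (hx : x ∈ simplexSet y)
    (j : Fin 2) : 0 ≤ c j + a j ⬝ᵥ x := by
  have hconv : Convex ℝ {x : Fin 1 → ℝ | 0 ≤ c j + a j ⬝ᵥ x} := by
    intro u hu v hv r s hr hs hrs
    simp only [Set.mem_ofPred_eq, dotProduct_add, dotProduct_smul, smul_eq_mul] at hu hv ⊢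
    have : c j + (r * a j ⬝ᵥ u + s * a j ⬝ᵥ v) =
        r * (c j + a j ⬝ᵥ u) + s * (c j + a j ⬝ᵥ v) := by
      linear_combination (-c j) * hrs
    rw [this]
    positivity
  refine convexHull_min ?_ hconv hx
  rintro _ ⟨l, rfl⟩
  rw [Set.mem_ofPred_eq, h j l]
  split_ifs <;> norm_num

/-- In one variable duality forces opposite slopes, so the two values sum to one and are the weights
of `x` as a combination of the endpoints. -/
lemma mem_simplexSet (h : IsDual y c a) {x : Fin 1 → ℝ} (hx : ∀ j, 0 < c j + a j ⬝ᵥ x) :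
    x ∈ simplexSet y := by
  have h00 := h 0 0
  have h01 := h 0 1
  have h10 := h 1 0
  have h11 := h 1 1
  simp only [dotProduct, Fin.sum_univ_one, Fin.isValue, if_true, zero_ne_one, one_ne_zero,
    if_false] at h00 h01 h10 h11
  have hD : a 0 0 * (y 0 0 - y 1 0) = 1 := by linarith
  have hD' : a 1 0 * (y 0 0 - y 1 0) = -1 := by linarith
  have ha : a 1 0 = -a 0 0 := by
    have hne : y 0 0 - y 1 0 ≠ 0 := fun h0 => by simp [h0] at hD
    exact mul_right_cancel₀ hne (by linarith)
  have hsum : ∑ j, (c j + a j ⬝ᵥ x) = 1 := by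
    simp only [Fin.sum_univ_two, dotProduct, Fin.sum_univ_one, ha]
    rw [ha] at h10 h11
    linarith
  have hcomb : ∑ j, (c j + a j ⬝ᵥ x) • y j = x := by
    funext i
    rw [Subsingleton.elim i 0]
    simp only [Fin.sum_univ_two, dotProduct, Fin.sum_univ_one, ha, Pi.add_apply, Pi.smul_apply,
      smul_eq_mul]
    rw [ha] at h10 h11
    linear_combination (x 0) * hD + y 0 0 * h01 + y 1 0 * h10
  rw [← hcomb]
  exact (convex_convexHull ℝ _).sum_mem (fun j _ => (hx j).le) hsum fun j _ =>
    subset_convexHull ℝ _ ⟨j, rfl⟩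

/-- A polynomial which is nonnegative on a segment and has integral zero vanishes. -/
lemma eq_zero_of_simplexInt_eq_zero (h : IsDual y c a) {g : Poly 1}
    (hg : ∀ x, (∀ j, 0 ≤ c j + a j ⬝ᵥ x) → 0 ≤ eval x g) (h0 : simplexInt y g = 0) : g = 0 := by
  set U : Set (Fin 1 → ℝ) := {x | ∀ j, 0 < c j + a j ⬝ᵥ x} with hU
  have hUo : IsOpen U := by
    simp only [hU, Set.ofPred_forall]
    refine isOpen_iInter_of_finite fun j => isOpen_lt continuous_const ?_
    simp only [dotProduct]
    fun_prop
  have hUne : U.Nonempty := by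
    refine ⟨(1 / 2 : ℝ) • y 0 + (1 / 2 : ℝ) • y 1, fun j => ?_⟩
    have h0 := h j 0
    have h1 := h j 1
    simp only [dotProduct_add, dotProduct_smul, smul_eq_mul]
    fin_cases j <;> simp at h0 h1 ⊢ <;> linarith
  have hUS : U ⊆ simplexSet y := fun x hx => h.mem_simplexSet hx
  have hmeas : MeasurableSet (simplexSet y) :=
    ((Set.finite_range y).isCompact_convexHull (𝕜 := ℝ)).measurableSet
  have hae : (fun s => eval s g) =ᵐ[volume.restrict (simplexSet y)] 0 := by
    refine (setIntegral_eq_zero_iff_of_nonneg_ae ?_ (integrableOn_eval y g)).1 h0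
    exact (ae_restrict_iff' hmeas).2 (ae_of_all _ fun x hx =>
      hg x fun j => h.nonneg_of_mem_simplexSet hx j)
  have heq := Measure.eqOn_open_of_ae_eq (ae_restrict_of_ae_restrict_of_subset hUS hae) hUo
    (MvPolynomial.continuous_eval g).continuousOn continuousOn_const
  exact eq_zero_of_eqOn_isOpen hUo hUne fun x hx => heq hx

lemma eq_zero_of_l2_self (h : IsDual y c a) {p : Poly 1} (h0 : l2 y p p = 0) : p = 0 := by
  have := h.eq_zero_of_simplexInt_eq_zero (g := p * p)
    (fun x _ => by rw [map_mul]; exact mul_self_nonneg _) h0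
  exact mul_self_eq_zero.1 this

/-- The weight `(λ₀λ₁)³` is nonnegative on the segment, so the weighted integral of `p²` is still
definite. -/
lemma eq_zero_of_l2_cube_mul (h : IsDual y c a) {p : Poly 1}
    (h0 : l2 y ((∏ j, aff (c j) (a j)) ^ 3 * p) p = 0) : p = 0 := by
  rw [l2_apply] at h0
  have := h.eq_zero_of_simplexInt_eq_zero (g := (∏ j, aff (c j) (a j)) ^ 3 * p * p)
    (fun x hx => by
      simp only [map_mul, map_pow, map_prod, HuCurl.eval_aff, mul_assoc]
      exact mul_nonneg (pow_nonneg (Finset.prod_nonneg fun j _ => hx j) 3) (mul_self_nonneg _)) h0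
  rw [mul_assoc] at this
  exact mul_self_eq_zero.1 ((mul_eq_zero.1 this).resolve_left (pow_ne_zero 3 h.prod_ne_zero))

end IsDual

/-! ### Vanishing on the edges -/

lemma eq_C_of_mem_Pk_zero {d : ℕ} {p : Poly d} (hp : p ∈ Pk d 0) : ∃ c, p = C c :=
  ⟨_, totalDegree_eq_zero_iff_eq_C.1 (Nat.le_zero.1 (mem_Pk.1 hp))⟩

lemma eq_affine_of_mem_Pk_one {p : Poly 1} (hp : p ∈ Pk 1 1) : ∃ c b, p = C c + C b * X 0 := by
  have hX : (X 0 : Poly 1) = aff 0 1 := by simp [aff]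
  obtain ⟨q, hq⟩ : aff 0 1 ∣ p - C (eval 0 p) := by
    refine (aff_dvd_iff (one_ne_zero) _).2 fun x hx => ?_
    have : x = 0 := funext fun i => by
      rw [Subsingleton.elim i 0]
      simpa [dotProduct] using hx
    rw [map_sub, eval_C, this, sub_self]
  have hm : aff 0 1 * q ∈ Pk 1 1 := hq ▸ Submodule.sub_mem _ hp (C_mem_Pk _)
  have hq' := mem_Pk_of_mul (aff_ne_zero one_ne_zero) hm
  rw [totalDegree_aff one_ne_zero] at hq'
  obtain ⟨b, rfl⟩ := eq_C_of_mem_Pk_zero hq'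
  exact ⟨eval 0 p, b, by rw [hX, mul_comm, ← hq]; ring⟩

variable {K : Tet} {F : Frame K} {k : ℕ}

lemma mem_jet2_of_dofB {s : PkS k} (h : dofB K k s = 0) (j : Fin 4) (i l : Fin 3) :
    s.1 i l ∈ jet2 (K j) := by
  have key : ∀ a : MIdx, eval (K j) (mpd (fun m => (a.1 m : ℕ)) (s.1 i l)) = 0 := fun a =>
    congrFun (congrFun (congrArg Subtype.val (congrFun (congrFun h j) a)) i) l
  -- The ten multi-indices of order at most two; the remaining orders of mixed differentiation
  -- follow by symmetry.
  have h00 := key ⟨![0, 0, 0], by decide⟩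
  have h0 := key ⟨![1, 0, 0], by decide⟩
  have h1 := key ⟨![0, 1, 0], by decide⟩
  have h2 := key ⟨![0, 0, 1], by decide⟩
  have h3 := key ⟨![2, 0, 0], by decide⟩
  have h4 := key ⟨![0, 2, 0], by decide⟩
  have h5 := key ⟨![0, 0, 2], by decide⟩
  have h6 := key ⟨![1, 1, 0], by decide⟩
  have h7 := key ⟨![1, 0, 1], by decide⟩
  have h8 := key ⟨![0, 1, 1], by decide⟩
  simp [mpd, pow_two] at h00 h0 h1 h2 h3 h4 h5 h6 h7 h8
  exact ⟨h00, fun | 0 => h0 | 1 => h1 | 2 => h2, fun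
    | 0, 0 => h3 | 0, 1 => h6 | 0, 2 => h7
    | 1, 0 => by rw [pd_comm]; exact h6
    | 1, 1 => h4 | 1, 2 => h8
    | 2, 0 => by rw [pd_comm]; exact h7
    | 2, 1 => by rw [pd_comm]; exact h8
    | 2, 2 => h5⟩

lemma edgeRestr_comp_mem_edgeSpace {s : Matrix (Fin 3) (Fin 3) (Poly 3)} (hs : s ∈ PkS k)
    (hj : ∀ j i l, s i l ∈ jet2 (K j)) (e : Edge) (a b : Fin 3 → ℝ) :
    edgeRestr F e (comp a b s) ∈ edgeSpace F k e := by
  have hm : edgeRestr F e (comp a b s) ∈ Pk 1 k := restr_mem_Pk _ _ (comp_mem hs.2 a b)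
  obtain ⟨q, hq, h⟩ := (isDual_edge F e).exists_eq_cube_mul hm fun j => restr_mem_jet2 <| by
    change _ ∈ jet2 (edgePar F e (edgePts F e j))
    rw [edgePar_edgePts]
    exact comp_mem (hj _) a b
  exact mem_mulBy.2 ⟨q, hq, by rw [edgeBub_eq]; exact h⟩

lemma comp_eq_sum (a b : Fin 3 → ℝ) (s : Matrix (Fin 3) (Fin 3) (Poly 3)) :
    comp a b s = ∑ i, a i • comp (Pi.single i 1) b s := by
  simp only [comp, LinearMap.sum_apply, LinearMap.smul_apply, Matrix.entryLinearMap_apply]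
  refine Finset.sum_congr rfl fun i _ => ?_
  conv_rhs => rw [Finset.sum_eq_single i (fun l _ hl => by simp [hl]) (by simp), Finset.smul_sum]
  exact Finset.sum_congr rfl fun j _ => by simp [mul_smul]

/-- Constant fields give the moments against `1`. On the edge the field `x` equals `x₀ + s t`, so
after the constant part is removed it gives the first moment of `tᵀσt`. -/
lemma l2_comp_t_eq_zero {s : Matrix (Fin 3) (Fin 3) (Poly 3)} (h : dofA F s = 0) (e : Edge) :
    (∀ a, l2 (edgePts F e) (edgeRestr F e (comp a (F.t e) s)) 1 = 0) ∧
      l2 (edgePts F e) (edgeRestr F e (comp (F.t e) (F.t e) s)) (X 0) = 0 := by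
  have key : ∀ w ∈ RT, ∑ i, l2 (edgePts F e) (edgeRestr F e (comp (Pi.single i 1) (F.t e) s))
      (edgeRestr F e (w i)) = 0 := fun w hw => by
    have : l2Vec (edgePts F e) 3 (edgeRestrV F e (mulVecC (F.t e) s)) (edgeRestrV F e w) = 0 :=
      LinearMap.congr_fun (congrFun h e) ⟨w, hw⟩
    rwa [l2Vec_apply] at this
  have hC : ∀ c : ℝ, edgeRestr F e (C c) = c • 1 := fun c => by
    rw [← algebraMap_eq, AlgHom.commutes, Algebra.algebraMap_eq_smul_one]
  have hlin : ∀ (a : Fin 3 → ℝ) (p : Poly 1), l2 (edgePts F e)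
      (edgeRestr F e (comp a (F.t e) s)) p = ∑ i, a i * l2 (edgePts F e)
      (edgeRestr F e (comp (Pi.single i 1) (F.t e) s)) p := fun a p => by
    rw [comp_eq_sum]
    simp
  have h1 : ∀ a, l2 (edgePts F e) (edgeRestr F e (comp a (F.t e) s)) 1 = 0 := fun a => by
    have := key (fun i => C (a i)) ⟨a, 0, fun i => by simp⟩
    simp only [hC, map_smul, smul_eq_mul] at this
    rw [hlin, this]
  refine ⟨h1, ?_⟩
  have hX : ∀ i, edgeRestr F e (X i) = edgeVert K e 0 i • 1 + F.t e i • X 0 := fun i => by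
    rw [edgeRestr, restr_X, aff, Fin.sum_univ_one, MvPolynomial.smul_eq_C_mul, mul_one,
      MvPolynomial.smul_eq_C_mul]
  have := key (fun i => X i) ⟨0, 1, fun i => by simp⟩
  simp only [hX, map_add, map_smul, smul_eq_mul, Finset.sum_add_distrib] at this
  rw [← hlin, ← hlin, h1, zero_add] at this
  exact this

/-- Each component in the edge frame is an admissible test function for its own moment, which is
therefore its squared L² norm. -/
lemma edgeRestr_comp_eq_zero {s : PkS k} (h : dof F k s = 0) (e : Edge) (a b : Fin 3 → ℝ) :
    edgeRestr F e (comp a b s.1) = 0 := by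
  have hA : dofA F s.1 = 0 := congrArg Prod.fst h
  have hB : dofB K k s = 0 := congrArg (fun x => x.2.1) h
  have hC : dofC F k s.1 = 0 := congrArg (fun x => x.2.2.1) h
  have hD : dofD F k s.1 = 0 := congrArg (fun x => x.2.2.2.1) h
  have hE : dofE F k s.1 = 0 := congrArg (fun x => x.2.2.2.2.1) h
  have hmem := edgeRestr_comp_mem_edgeSpace (F := F) s.2 (mem_jet2_of_dofB hB) e
  obtain ⟨h1, hX⟩ := l2_comp_t_eq_zero hA e
  have hdef := fun p => (isDual_edge F e).eq_zero_of_l2_self (p := p)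
  have htt : edgeRestr F e (comp (F.t e) (F.t e) s.1) = 0 := by
    refine hdef _ (LinearMap.congr_fun (congrFun hC e) ⟨_, hmem _ _, fun z hz => ?_⟩)
    obtain ⟨c, b, rfl⟩ := eq_affine_of_mem_Pk_one hz
    rw [← mul_one (C c), ← MvPolynomial.smul_eq_C_mul, ← MvPolynomial.smul_eq_C_mul]
    simp [h1, hX]
  have hnt : ∀ j, edgeRestr F e (comp (F.nE e j) (F.t e) s.1) = 0 := fun j => by
    refine hdef _ (LinearMap.congr_fun (congrFun (congrFun hD e) j) ⟨_, hmem _ _, fun z hz => ?_⟩)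
    obtain ⟨c, rfl⟩ := eq_C_of_mem_Pk_zero hz
    rw [← mul_one (C c), ← MvPolynomial.smul_eq_C_mul]
    simp [h1]
  have hnn' : ∀ j j', j ≤ j' → edgeRestr F e (comp (F.nE e j) (F.nE e j') s.1) = 0 :=
    fun j j' hj => hdef _
      (LinearMap.congr_fun (congrFun (congrFun hE e) ⟨(j, j'), hj⟩) ⟨_, hmem _ _⟩)
  have hnn : ∀ j j', edgeRestr F e (comp (F.nE e j) (F.nE e j') s.1) = 0 := fun j j' => by
    rcases le_total j j' with hj | hj
    · exact hnn' j j' hj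
    · rw [comp_symm s.2.1, hnn' j' j hj]
  have htn : ∀ j, edgeRestr F e (comp (F.t e) (F.nE e j) s.1) = 0 := fun j => by
    rw [comp_symm s.2.1, hnt]
  refine MvPolynomial.funext fun x => ?_
  have hM : s.1.map (eval (edgePar F e x)) = 0 := by
    refine (isONFrame_edgeFrame F e).matrix_eq fun i j => ?_
    rw [← eval_comp, ← eval_edgeRestr]
    fin_cases i <;> fin_cases j <;> simp [edgeFrame, htt, hnt, hnn, htn]
  rw [eval_edgeRestr, eval_comp, hM]
  simp

/-! ### From edges to faces -/

lemma exists_edge_of_ne : ∀ j l : Fin 4, j ≠ l →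
    ∃ u v : Fin 4, u < v ∧ ∀ i, i ∉ ({u, v} : Finset (Fin 4)) → i = j ∨ i = l := by
  decide

/-- Where two barycentric coordinates vanish, the other two sum to one, so the point lies on the
line through the two remaining vertices. -/
lemma exists_edgePar_eq (F : Frame K) {j l : Fin 4} (hjl : j ≠ l) {x : Fin 3 → ℝ}
    (hj : K.coord j x = 0) (hl : K.coord l x = 0) : ∃ e y, edgePar F e y = x := by
  obtain ⟨u, v, huv, h⟩ := exists_edge_of_ne j l hjl
  have h0 : ∀ i, i ∉ ({u, v} : Finset (Fin 4)) → K.coord i x = 0 := fun i hi => by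
    rcases h i hi with rfl | rfl <;> assumption
  have h1 : K.coord u x + K.coord v x = 1 := by
    rw [← K.sum_coord_apply_eq_one x, ← Finset.sum_subset (Finset.subset_univ {u, v})
      fun i _ hi => h0 i hi, Finset.sum_pair huv.ne]
  have h2 : K.coord u x • K u + K.coord v x • K v = x := by
    conv_rhs => rw [← sum_coord_smul K x, ← Finset.sum_subset (Finset.subset_univ {u, v})
      fun i _ hi => by rw [h0 i hi, zero_smul], Finset.sum_pair huv.ne]
  obtain ⟨c, hc⟩ := F.t_tangent ⟨(u, v), huv⟩
  refine ⟨⟨(u, v), huv⟩, fun _ => K.coord v x * c, ?_⟩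
  simp only [edgePar, param, Finset.univ_unique, Finset.sum_singleton, mul_smul, ← hc]
  change K u + K.coord v x • (K v - K u) = x
  conv_rhs => rw [← h2, eq_sub_of_add_eq h1]
  module

/-- A matrix field all of whose components vanish on the edges vanishes on the lines spanned by
them. -/
lemma map_eval_eq_zero_of_edge {s : Matrix (Fin 3) (Fin 3) (Poly 3)}
    (h : ∀ e a b, edgeRestr F e (comp a b s) = 0) {j l : Fin 4} (hjl : j ≠ l) {x : Fin 3 → ℝ}
    (hj : K.coord j x = 0) (hl : K.coord l x = 0) : s.map (eval x) = 0 := by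
  obtain ⟨e, y, rfl⟩ := exists_edgePar_eq F hjl hj hl
  refine (isONFrame_edgeFrame F e).matrix_eq fun i j => ?_
  rw [← eval_comp, ← eval_edgeRestr, h]
  simp

/-- At `y l` the two other factors vanish and the factor `l` equals one. Along `(y j - y l) + (y j'
- y l)` both vanishing factors have slope one, so the second derivative is `2 q(y l)`. -/
lemma IsDual.eval_eq_zero_of_mem_jet2 {n d : ℕ} {y : Fin n → Fin d → ℝ} {c : Fin n → ℝ}
    {a : Fin n → Fin d → ℝ} (h : IsDual y c a) {j j' l : Fin n} (hjj' : j ≠ j') (hjl : j ≠ l)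
    (hjl' : j' ≠ l) {q : Poly d}
    (hq : aff (c j) (a j) * aff (c j') (a j') * (aff (c l) (a l) * q) ∈ jet2 (y l)) :
    eval (y l) q = 0 := by
  have key : ∀ u v, u ≠ v → u ≠ l → v ≠ l →
      a u ⬝ᵥ ((y u - y l) + (y v - y l)) = 1 := fun u v huv hul hvl => by
    have h1 := h u v
    have h2 := h u l
    rw [if_neg huv] at h1
    rw [if_neg hul] at h2
    rw [dotProduct_add, h.dot_sub hul, dotProduct_sub]
    linarith
  have h1 := eval_eq_zero_of_mul_mul_mem_jet2 (v := (y j - y l) + (y j' - y l))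
    (by rw [h j l, if_neg hjl]) (by rw [h j' l, if_neg hjl']) (key j j' hjj' hjl hjl')
    (by rw [add_comm]; exact key j' j hjj'.symm hjl' hjl) hq
  rwa [map_mul, h.eval_aff, if_pos rfl, one_mul] at h1

lemma IsDual.eval_eq_zero_of_prod_mul_mem_jet2 {d : ℕ} {y : Fin 3 → Fin d → ℝ} {c : Fin 3 → ℝ}
    {a : Fin 3 → Fin d → ℝ} (h : IsDual y c a) {q : Poly d} (l : Fin 3)
    (hq : (∏ j, aff (c j) (a j)) * q ∈ jet2 (y l)) : eval (y l) q = 0 := by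
  rw [Fin.prod_univ_three] at hq
  match l with
  | 0 =>
    exact h.eval_eq_zero_of_mem_jet2 (j := 1) (j' := 2) (by decide) (by decide) (by decide)
      (by convert hq using 1; ring)
  | 1 =>
    exact h.eval_eq_zero_of_mem_jet2 (j := 0) (j' := 2) (by decide) (by decide) (by decide)
      (by convert hq using 1; ring)
  | 2 =>
    exact h.eval_eq_zero_of_mem_jet2 (j := 0) (j' := 1) (by decide) (by decide) (by decide)
      (by convert hq using 1; ring)

lemma faceRestr_comp_mem_faceSpace {s : Matrix (Fin 3) (Fin 3) (Poly 3)} (hs : s ∈ PkS k)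
    (hj : ∀ j i l, s i l ∈ jet2 (K j)) (h : ∀ e a b, edgeRestr F e (comp a b s) = 0)
    (i : Fin 4) (a b : Fin 3 → ℝ) : faceRestr F i (comp a b s) ∈ faceSpace F k i := by
  have hm : faceRestr F i (comp a b s) ∈ Pk 2 k := restr_mem_Pk _ _ (comp_mem hs.2 a b)
  obtain ⟨q, hq, hpq⟩ := (isDual_face F i).exists_eq_mul hm fun j x hx => by
    -- On the plane of face `i`, a further vanishing coordinate describes the line of an edge, where
    -- the field is already zero.
    rw [add_assoc, ← dot_param, coord_eq] at hx
    rw [eval_faceRestr, eval_comp,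
      map_eval_eq_zero_of_edge h (Fin.succAbove_ne i j) hx (coord_facePar F i x)]
    simp
  refine mem_mulBy.2 ⟨q, ⟨hq, fun l => ?_⟩, by rw [faceBub_eq]; exact hpq⟩
  refine (isDual_face F i).eval_eq_zero_of_prod_mul_mem_jet2 l ?_
  rw [← hpq]
  refine restr_mem_jet2 ?_
  change _ ∈ jet2 (facePar F i (facePts F i l))
  rw [facePar_facePts]
  exact comp_mem (hj _) a b

lemma IsInnerProductOn.eq_zero {M : Type} [AddCommGroup M] [Module ℝ M]
    {B : LinearMap.BilinForm ℝ M} {W : Submodule ℝ M} (h : IsInnerProductOn B W) {u : M}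
    (hu : u ∈ W) (h0 : B u u = 0) : u = 0 := by
  by_contra hne
  exact (h.2 u hu hne).ne' h0

/-! ### Extension from a face to the cell -/

/-- The extension of a polynomial on a face to the cell, constant along the edge between the
opposite vertex and the first vertex of the face. -/
def faceExt (F : Frame K) (i : Fin 4) : Poly 2 →ₐ[ℝ] Poly 3 :=
  aeval fun m => aff (-(F.tF i m ⬝ᵥ faceVert K i 0)) (F.tF i m) -
    C (F.tF i m ⬝ᵥ (K i - faceVert K i 0)) * bary K i

lemma eval_faceExt (i : Fin 4) (q : Poly 2) (x : Fin 3 → ℝ) : eval x (faceExt F i q) =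
    eval (fun m => (x - faceVert K i 0 - K.coord i x • (K i - faceVert K i 0)) ⬝ᵥ F.tF i m) q := by
  rw [faceExt, eval_aeval]
  congr 2
  funext m
  rw [map_sub, eval_aff, map_mul, eval_C, eval_bary, dotProduct_comm _ (F.tF i m)]
  simp only [dotProduct_sub, dotProduct_smul, smul_eq_mul]
  ring

lemma eval_faceExt_of_coord_eq_zero {i : Fin 4} (q : Poly 2) {x : Fin 3 → ℝ}
    (hx : K.coord i x = 0) : eval x (faceExt F i q) =
      eval (fun m => (x - faceVert K i 0) ⬝ᵥ F.tF i m) q := by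
  rw [eval_faceExt, hx, zero_smul, sub_zero]

lemma faceExt_mem_Pk {i : Fin 4} {q : Poly 2} {m : ℕ} (hq : q ∈ Pk 2 m) :
    faceExt F i q ∈ Pk 3 m := by
  refine aeval_mem_Pk (fun l => Submodule.sub_mem _ (aff_mem_Pk _ _) ?_) hq
  rw [← MvPolynomial.smul_eq_C_mul]
  exact Submodule.smul_mem _ _ (aff_mem_Pk _ _)

lemma faceExt_mem_P0 {i : Fin 4} {q : Poly 2} {m : ℕ} (hq : q ∈ P0 (facePts F i) m) :
    faceExt F i q ∈ P0 K m := by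
  refine ⟨faceExt_mem_Pk hq.1, fun j => ?_⟩
  -- The projection behind `faceExt` sends the opposite vertex to the first vertex of the face, so
  -- vanishing at the three face vertices suffices.
  rcases eq_or_ne j i with rfl | hj
  · rw [eval_faceExt, ← hq.2 0]
    congr 2
    funext m
    simp [facePts, localPts]
  · obtain ⟨l, rfl⟩ := Fin.exists_succAbove_eq hj
    rw [eval_faceExt_of_coord_eq_zero _ (by simp [Fin.ne_succAbove])]
    exact hq.2 l

lemma faceRestr_mem_P0 {i : Fin 4} {p : Poly 3} {m : ℕ} (hp : p ∈ P0 K m) :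
    faceRestr F i p ∈ P0 (facePts F i) m := by
  refine ⟨restr_mem_Pk _ _ hp.1, fun j => ?_⟩
  rw [eval_faceRestr, facePar_facePts]
  exact hp.2 _

lemma bary_dvd_iff (i : Fin 4) (p : Poly 3) :
    bary K i ∣ p ↔ ∀ x, K.coord i x = 0 → eval x p = 0 := by
  simp only [bary_eq_aff, aff_dvd_iff ((isDual_bary K).ne_zero i), coord_eq]

/-! ### From faces to the cell -/

/-- A matrix field is a multiple of the normal-normal field on a face if its tangential components
vanish there. -/
lemma map_eval_eq_of_face {s : Matrix (Fin 3) (Fin 3) (Poly 3)} (hs : s.IsSymm) {i : Fin 4}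
    (hTT : faceTT F i s = 0) (hTN : faceTN F i s = 0) {x : Fin 3 → ℝ} (hx : K.coord i x = 0)
    (a b : Fin 3) : eval x (s a b) = F.n i a * F.n i b * eval x (comp (F.n i) (F.n i) s) := by
  have hx' := facePar_of_coord_eq_zero F hx
  have hTT' : ∀ a b, eval x (comp (F.tF i a) (F.tF i b) s) = 0 := fun a b => by
    rw [← hx', ← eval_faceRestr]
    exact (congrArg (eval _) (congrFun (congrFun hTT a) b)).trans (map_zero _)
  have hTN' : ∀ a, eval x (comp (F.tF i a) (F.n i) s) = 0 := fun a => by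
    rw [← hx', ← eval_faceRestr]
    exact (congrArg (eval _) (congrFun hTN a)).trans (map_zero _)
  have hNT' : ∀ a, eval x (comp (F.n i) (F.tF i a) s) = 0 := fun a => by
    rw [comp_symm hs, hTN']
  have hM : s.map (eval x) = eval x (comp (F.n i) (F.n i) s) • Matrix.vecMulVec (F.n i) (F.n i) := by
    refine (isONFrame_faceFrame F i).matrix_eq fun a b => ?_
    have h0 : ∀ a, F.n i ⬝ᵥ F.tF i a = 0 := fun a => by rw [dotProduct_comm, F.tF_tangent]
    rw [← eval_comp, Matrix.smul_mulVec, Matrix.vecMulVec_mulVec]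
    fin_cases a <;> fin_cases b <;>
      simp [faceFrame, hTT', hTN', hNT', h0, F.tF_tangent, F.n_unit]
  have := congrFun (congrFun hM a) b
  rw [Matrix.map_apply] at this
  rw [this, Matrix.smul_apply, Matrix.vecMulVec_apply, smul_eq_mul, mul_comm]

/-- The product of the barycentric coordinates of the vertices of a face. -/
abbrev faceProd (K : Tet) (i : Fin 4) : Poly 3 := ∏ j : Fin 3, bary K (i.succAbove j)

lemma faceProd_mem_Pk (i : Fin 4) : faceProd K i ∈ Pk 3 3 := by
  refine mem_Pk.2 ((totalDegree_finsetProd _ _).trans ?_)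
  refine (Finset.sum_le_card_nsmul _ _ 1 fun j _ => mem_Pk.1 (aff_mem_Pk _ _)).trans ?_
  simp

lemma eval_faceProd_eq_zero {i i' : Fin 4} (h : i' ≠ i) {x : Fin 3 → ℝ}
    (hx : K.coord i' x = 0) : eval x (faceProd K i) = 0 := by
  obtain ⟨j, rfl⟩ := Fin.exists_succAbove_eq h
  rw [map_prod]
  exact Finset.prod_eq_zero (Finset.mem_univ j) (by rw [eval_bary, hx])

lemma nnT_apply (i : Fin 4) (p : Poly 3) (a b : Fin 3) :
    nnT F i p a b = (F.n i a * F.n i b) • p := rfl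

/-- On each face only a multiple of `n nᵀ` survives. The sum `S` of the extended multiples matches
`s` on every face, so the symmetric field `s - S` is divisible by the cell bubble. -/
lemma mem_cellSpace (hk : 3 ≤ k) {s : Matrix (Fin 3) (Fin 3) (Poly 3)} (hs : s ∈ PkS k)
    (hTT : ∀ i, faceTT F i s = 0) (hTN : ∀ i, faceTN F i s = 0)
    (hNN : ∀ i, faceRestr F i (comp (F.n i) (F.n i) s) ∈ faceSpace F k i) :
    s ∈ cellSpace F k := by
  choose q hq hq' using fun i => mem_mulBy.1 (hNN i)
  have hQ : ∀ i x, K.coord i x = 0 → eval x (faceProd K i * faceExt F i (q i)) =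
      eval x (comp (F.n i) (F.n i) s) := fun i x hx => by
    rw [map_mul, eval_faceExt_of_coord_eq_zero _ hx]
    conv_rhs => rw [← facePar_of_coord_eq_zero F hx, ← eval_faceRestr, hq', map_mul, faceBub,
      eval_faceRestr, facePar_of_coord_eq_zero F hx]
  set S := ∑ i, nnT F i (faceProd K i * faceExt F i (q i)) with hS
  have hSapp : ∀ a b, S a b = ∑ i, (F.n i a * F.n i b) • (faceProd K i * faceExt F i (q i)) :=
    fun a b => by
      rw [hS, Matrix.sum_apply]
      exact Finset.sum_congr rfl fun i _ => nnT_apply i _ a b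
  have hr : s - S ∈ symIn (mulBy (cellBub K) (Pk 3 (k - 4))) := by
    refine ⟨hs.1.sub ?_, fun a b => ?_⟩
    · refine Matrix.IsSymm.ext fun a b => ?_
      rw [hSapp, hSapp]
      exact Finset.sum_congr rfl fun i _ => by rw [mul_comm (F.n i b)]
    · have hm : (s - S) a b ∈ Pk 3 k := by
        rw [Matrix.sub_apply, hSapp]
        refine Submodule.sub_mem _ (hs.2 a b) (Submodule.sum_mem _ fun i _ =>
          Submodule.smul_mem _ _ ?_)
        have := mul_mem_Pk (faceProd_mem_Pk (K := K) i) (faceExt_mem_Pk (F := F) (i := i) (hq i).1)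
        rwa [Nat.add_sub_cancel' hk] at this
      obtain ⟨p, hp, h⟩ := (isDual_bary K).exists_eq_mul hm fun i x hx => by
        rw [coord_eq] at hx
        -- On face `i` the summands of the other faces drop out, since their products contain `λ_i`.
        rw [Matrix.sub_apply, hSapp, map_sub, map_sum, map_eval_eq_of_face hs.1 (hTT i) (hTN i) hx,
          Finset.sum_eq_single i, smul_eval, hQ i x hx, sub_self]
        · intro i' _ hi'
          rw [smul_eval, map_mul, eval_faceProd_eq_zero hi'.symm hx, zero_mul, mul_zero]
        · simp
      exact mem_mulBy.2 ⟨p, hp, h⟩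
  rw [← add_sub_cancel S s]
  refine Submodule.add_mem_sup (Submodule.sum_mem _ fun i _ => ?_) hr
  refine Submodule.mem_iSup_of_mem i ⟨_, mem_mulBy.2 ⟨_, faceExt_mem_P0 (hq i), rfl⟩, rfl⟩

/-! ### Injectivity of the degrees of freedom -/

lemma dof_injective (hk : 7 ≤ k)
    (hf : ∀ i, IsInnerProductOn (faceFormS F k i) (faceSpaceS F k i))
    (hg : ∀ i, IsInnerProductOn (faceFormV F k i) (faceSpaceV F k i))
    (hh : IsInnerProductOn (cellForm K k) (cellSpace F k)) :
    Function.Injective (dof F k) := by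
  refine (injective_iff_map_eq_zero _).2 fun s h => ?_
  have hB : dofB K k s = 0 := congrArg (fun x => x.2.1) h
  have hF : dofF F k s.1 = 0 := congrArg (fun x => x.2.2.2.2.2.1) h
  have hG : dofG F k s.1 = 0 := congrArg (fun x => x.2.2.2.2.2.2.1) h
  have hH : dofH F k s.1 = 0 := congrArg (fun x => x.2.2.2.2.2.2.2) h
  have hmem := faceRestr_comp_mem_faceSpace s.2 (mem_jet2_of_dofB hB) (edgeRestr_comp_eq_zero h)
  have hTT : ∀ i, faceTT F i s.1 = 0 := fun i => by
    have hm : faceTT F i s.1 ∈ faceSpaceS F k i :=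
      ⟨Matrix.IsSymm.ext fun a b => by
        change faceRestr F i (comp _ _ _) = faceRestr F i (comp _ _ _)
        rw [comp_symm s.2.1], fun a b => hmem i _ _⟩
    exact (hf i).eq_zero hm (LinearMap.congr_fun (congrFun hF i) ⟨_, hm⟩)
  have hTN : ∀ i, faceTN F i s.1 = 0 := fun i => by
    have hm : faceTN F i s.1 ∈ faceSpaceV F k i := fun a _ => hmem i _ _
    exact (hg i).eq_zero hm (LinearMap.congr_fun (congrFun hG i) ⟨_, hm⟩)
  have hm := mem_cellSpace (by omega) s.2 hTT hTN fun i => hmem i _ _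
  exact Subtype.ext (hh.eq_zero hm (LinearMap.congr_fun hH ⟨_, hm⟩))

/-! ### Dimensions -/

lemma six_mul_finrank_Pk_three (m : ℕ) :
    6 * Module.finrank ℝ (Pk 3 m) = (m + 1) * (m + 2) * (m + 3) := by
  have := Nat.ascFactorial_eq_factorial_mul_choose m 3
  simp only [Nat.ascFactorial_succ, Nat.ascFactorial_zero, Nat.factorial] at this
  rw [finrank_Pk, ← Nat.choose_symm_add, add_comm 3 m]
  linarith

lemma two_mul_finrank_Pk_two (m : ℕ) : 2 * Module.finrank ℝ (Pk 2 m) = (m + 1) * (m + 2) := by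
  have := Nat.ascFactorial_eq_factorial_mul_choose m 2
  simp only [Nat.ascFactorial_succ, Nat.ascFactorial_zero, Nat.factorial] at this
  rw [finrank_Pk, ← Nat.choose_symm_add, add_comm 2 m]
  linarith

lemma finrank_Pk_one (m : ℕ) : Module.finrank ℝ (Pk 1 m) = m + 1 := by
  rw [finrank_Pk, ← Nat.choose_symm_add, Nat.choose_one_right, add_comm]

/-! ### Dimensions of symmetric matrix fields and vector fields -/

section Fields

variable {d : ℕ} {A : Type} [AddCommGroup A] [Module ℝ A]

/-- A symmetric matrix is given by its entries on and above the diagonal. -/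
def symInEquiv (W : Submodule ℝ A) :
    symIn (d := d) W ≃ₗ[ℝ] ({p : Fin d × Fin d // p.1 ≤ p.2} → W) where
  toFun s p := ⟨s.1 p.1.1 p.1.2, s.2.2 _ _⟩
  invFun f := ⟨Matrix.of fun i j =>
      if h : i ≤ j then (f ⟨(i, j), h⟩ : A) else f ⟨(j, i), le_of_not_ge h⟩, by
    refine ⟨Matrix.IsSymm.ext fun i j => ?_, fun i j => ?_⟩
    · rcases lt_trichotomy i j with h | rfl | h
      · simp [h.le, h.not_ge]
      · rfl
      · simp [h.le, h.not_ge]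
    · rw [Matrix.of_apply]
      split_ifs <;> exact Subtype.mem _⟩
  map_add' _ _ := rfl
  map_smul' _ _ := rfl
  left_inv s := by
    refine Subtype.ext (Matrix.ext fun i j => ?_)
    simp only [Matrix.of_apply]
    split_ifs
    · rfl
    · exact s.2.1.apply i j
  right_inv f := by
    funext p
    refine Subtype.ext ?_
    simp [p.2]

variable (W : Submodule ℝ A) [FiniteDimensional ℝ W]

instance : FiniteDimensional ℝ (symIn (d := d) W) := (symInEquiv W).symm.finiteDimensional

lemma finrank_symIn : Module.finrank ℝ (symIn (d := d) W) =
    Fintype.card {p : Fin d × Fin d // p.1 ≤ p.2} * Module.finrank ℝ W := by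
  rw [(symInEquiv W).finrank_eq, Module.finrank_pi_fintype, Finset.sum_const, Finset.card_univ,
    smul_eq_mul]

/-- A vector field is given by its components. -/
def vecInEquiv (W : Submodule ℝ A) : vecIn (d := d) W ≃ₗ[ℝ] (Fin d → W) where
  toFun v i := ⟨v.1 i, v.2 i trivial⟩
  invFun f := ⟨fun i => f i, fun i _ => (f i).2⟩
  map_add' _ _ := rfl
  map_smul' _ _ := rfl
  left_inv _ := rfl
  right_inv _ := rfl

instance : FiniteDimensional ℝ (vecIn (d := d) W) := (vecInEquiv W).symm.finiteDimensional

lemma finrank_vecIn : Module.finrank ℝ (vecIn (d := d) W) = d * Module.finrank ℝ W := by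
  rw [(vecInEquiv W).finrank_eq, Module.finrank_pi_fintype, Finset.sum_const, Finset.card_univ,
    smul_eq_mul, Fintype.card_fin]

end Fields

/-! ### Dimension bounds for the test spaces -/

instance {d : ℕ} (p : Poly d) (W : Submodule ℝ (Poly d)) [FiniteDimensional ℝ W] :
    FiniteDimensional ℝ (mulBy p W) := by unfold mulBy; infer_instance

lemma finrank_mulBy_le {d : ℕ} (p : Poly d) (W : Submodule ℝ (Poly d)) [FiniteDimensional ℝ W] :
    Module.finrank ℝ (mulBy p W) ≤ Module.finrank ℝ W := Submodule.finrank_map_le _ _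

lemma finrank_mulBy {d : ℕ} {p : Poly d} (hp : p ≠ 0) (W : Submodule ℝ (Poly d)) :
    Module.finrank ℝ (mulBy p W) = Module.finrank ℝ W :=
  (Submodule.equivMapOfInjective (LinearMap.mulLeft ℝ p) (mul_right_injective₀ hp) W).finrank_eq.symm

instance {n d : ℕ} (v : Fin n → Fin d → ℝ) (m : ℕ) : FiniteDimensional ℝ (P0 v m) :=
  Submodule.finiteDimensional_of_le (S₂ := Pk d m) fun _ h => h.1

lemma finrank_add_le_of_disjoint {V : Type} [AddCommGroup V] [Module ℝ V] {A B W : Submodule ℝ V}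
    [FiniteDimensional ℝ W] (hA : A ≤ W) (hB : B ≤ W) (h : Disjoint A B) :
    Module.finrank ℝ A + Module.finrank ℝ B ≤ Module.finrank ℝ W := by
  have := Submodule.finiteDimensional_of_le hA
  have := Submodule.finiteDimensional_of_le hB
  have h1 := Submodule.finrank_sup_add_finrank_inf_eq A B
  rw [h.eq_bot, finrank_bot, add_zero] at h1
  rw [← h1]
  exact Submodule.finrank_mono (sup_le hA hB)

/-- The `n` point evaluations are independent on polynomials of positive degree. -/
lemma IsDual.finrank_P0_add_le {n d m : ℕ} {y : Fin n → Fin d → ℝ} {c : Fin n → ℝ}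
    {a : Fin n → Fin d → ℝ} (h : IsDual y c a) (hm : 1 ≤ m) :
    Module.finrank ℝ (P0 y m) + n ≤ Module.finrank ℝ (Pk d m) := by
  -- The dual affine polynomials realize any prescribed values at the points, so their span is an
  -- `n`-dimensional space meeting `P0 y m` trivially.
  set L := Fintype.linearCombination ℝ fun j => aff (c j) (a j) with hL
  have hLy : ∀ u l, eval (y l) (L u) = u l := fun u l => by
    simp only [hL, Fintype.linearCombination_apply, map_sum, smul_eval, h.eval_aff, mul_ite,
      mul_one, mul_zero, Finset.sum_ite_eq', Finset.mem_univ, if_true]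
  have hinj : Function.Injective L := fun u v huv => funext fun l => by
    rw [← hLy u, ← hLy v, huv]
  have h1 := finrank_add_le_of_disjoint (A := P0 y m) (B := LinearMap.range L) (W := Pk d m)
    (fun _ h => h.1) ?_ ?_
  · rwa [LinearMap.finrank_range_of_inj hinj, Module.finrank_fin_fun] at h1
  · rintro _ ⟨u, rfl⟩
    rw [hL, Fintype.linearCombination_apply]
    exact Submodule.sum_mem _ fun j _ => Submodule.smul_mem _ _ (Pk_mono hm (aff_mem_Pk _ _))
  · rw [Submodule.disjoint_def]
    rintro _ hu ⟨u, rfl⟩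
    rw [show u = 0 from funext fun l => by rw [← hLy u, hu.2 l]; rfl, map_zero]

/-- The parametrization of `RT`. -/
def rtMap : (Fin 3 → ℝ) × ℝ →ₗ[ℝ] (Fin 3 → Poly 3) where
  toFun u i := C (u.1 i) + C u.2 * X i
  map_add' u v := by
    funext i
    simp only [Prod.fst_add, Prod.snd_add, Pi.add_apply, map_add]
    ring
  map_smul' r u := by
    funext i
    simp only [Prod.smul_fst, Prod.smul_snd, Pi.smul_apply, smul_eq_mul, map_mul,
      MvPolynomial.smul_eq_C_mul, RingHom.id_apply]
    ring

lemma RT_eq_range : RT = LinearMap.range rtMap := by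
  ext w
  constructor
  · rintro ⟨a, b, h⟩
    exact ⟨(a, b), funext fun i => (h i).symm⟩
  · rintro ⟨u, rfl⟩
    exact ⟨u.1, u.2, fun _ => rfl⟩

instance : FiniteDimensional ℝ RT := by rw [RT_eq_range]; infer_instance

lemma finrank_RT_le : Module.finrank ℝ RT ≤ 4 := by
  rw [RT_eq_range]
  refine (LinearMap.finrank_range_le _).trans ?_
  simp

instance (e : Edge) : FiniteDimensional ℝ (edgeSpace F k e) := by
  unfold edgeSpace; infer_instance

instance (m : ℕ) (e : Edge) : FiniteDimensional ℝ (edgeSpaceMod F k m e) :=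
  Submodule.finiteDimensional_of_le (S₂ := edgeSpace F k e) fun _ h => h.1

instance (i : Fin 4) : FiniteDimensional ℝ (faceSpace F k i) := by
  unfold faceSpace; infer_instance

lemma finrank_edgeSpace_le (e : Edge) : Module.finrank ℝ (edgeSpace F k e) ≤ k - 6 + 1 :=
  (finrank_mulBy_le _ _).trans (finrank_Pk_one _).le

/-- `P_m` need not lie inside the edge space, so `(λ₀λ₁)³ P_m` serves as the complementary subspace:
an element of it orthogonal to `P_m` has zero weighted norm. -/
lemma finrank_edgeSpaceMod_add_le {m : ℕ} (hm : m ≤ k - 6) (e : Edge) :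
    Module.finrank ℝ (edgeSpaceMod F k m e) + (m + 1) ≤ k - 6 + 1 := by
  have hb : edgeBub F e ^ 3 ≠ 0 := by
    rw [edgeBub_eq]
    exact pow_ne_zero 3 (isDual_edge F e).prod_ne_zero
  rw [← finrank_Pk_one m, ← finrank_mulBy hb (Pk 1 m)]
  refine (finrank_add_le_of_disjoint (W := edgeSpace F k e) (fun _ (h : _ ∈ edgeSpaceMod F k m e) => h.1)
    (Submodule.map_mono (Pk_mono hm)) ?_).trans (finrank_edgeSpace_le e)
  rw [Submodule.disjoint_def]
  intro p hp hp'
  obtain ⟨q, hq, rfl⟩ := mem_mulBy.1 hp'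
  have h0 := hp.2 q hq
  rw [edgeBub_eq] at h0
  rw [(isDual_edge F e).eq_zero_of_l2_cube_mul h0, mul_zero]

lemma finrank_faceSpace_le (i : Fin 4) : Module.finrank ℝ (faceSpace F k i) ≤
    Module.finrank ℝ (P0 (facePts F i) (k - 3)) := finrank_mulBy_le _ _

/-- Modulo `λ₀ λ₁ λ₂ λ₃ P_{k-4}(K; 𝕊)`, the cell bubble space only depends on the faces. -/
lemma cellSpace_le : cellSpace F k ≤
    (⨆ i : Fin 4, ((mulBy (faceProd K i)
      ((P0 (facePts F i) (k - 3)).map (faceExt F i).toLinearMap)).map (nnT F i))) ⊔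
    symIn (mulBy (cellBub K) (Pk 3 (k - 4))) := by
  refine sup_le (iSup_le fun i => ?_) le_sup_right
  rintro _ ⟨_, hp, rfl⟩
  obtain ⟨p, hp', rfl⟩ := mem_mulBy.1 hp
  clear hp
  have hr := faceRestr_mem_P0 (F := F) (i := i) hp'
  -- A polynomial and the extension of its trace agree on face `i`; their difference supplies the
  -- factor `λ_i` that completes the face product to the cell bubble.
  obtain ⟨q, hq⟩ : bary K i ∣ p - faceExt F i (faceRestr F i p) := by
    refine (bary_dvd_iff i _).2 fun x hx => ?_
    rw [map_sub, eval_faceExt_of_coord_eq_zero _ hx, eval_faceRestr,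
      facePar_of_coord_eq_zero F hx, sub_self]
  have hq' : q ∈ Pk 3 (k - 4) := by
    have hm : bary K i * q ∈ Pk 3 (k - 3) :=
      hq ▸ Submodule.sub_mem _ hp'.1 (faceExt_mem_Pk hr.1)
    have hne := (isDual_bary K).ne_zero i
    have := mem_Pk_of_mul (aff_ne_zero hne) hm
    rwa [totalDegree_aff hne, Nat.sub_sub] at this
  rw [← add_sub_cancel (faceExt F i (faceRestr F i p)) p, hq, mul_add, map_add]
  refine Submodule.add_mem_sup (Submodule.mem_iSup_of_mem i
    ⟨_, mem_mulBy.2 ⟨_, ⟨_, hr, rfl⟩, rfl⟩, rfl⟩) ⟨Matrix.IsSymm.ext fun a b => ?_, fun a b => ?_⟩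
  · rw [nnT_apply, nnT_apply, mul_comm (F.n i a)]
  · rw [nnT_apply]
    refine Submodule.smul_mem _ _ (mem_mulBy.2 ⟨q, hq', ?_⟩)
    rw [cellBub, Fin.prod_univ_succAbove _ i]
    ring

lemma finrank_iSup_fin_four_le {V : Type} [AddCommGroup V] [Module ℝ V] (W : Fin 4 → Submodule ℝ V)
    [∀ i, FiniteDimensional ℝ (W i)] :
    Module.finrank ℝ (⨆ i, W i : Submodule ℝ V) ≤ ∑ i, Module.finrank ℝ (W i) := by
  have : ∀ s : Finset (Fin 4), Module.finrank ℝ (s.sup W : Submodule ℝ V) ≤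
      ∑ i ∈ s, Module.finrank ℝ (W i) := fun s => by
    induction s using Finset.induction_on with
    | empty => simp
    | insert i s hi ih =>
      rw [Finset.sup_insert, Finset.sum_insert hi]
      exact (Submodule.finrank_add_le_finrank_add_finrank _ _).trans (Nat.add_le_add_left ih _)
  rw [← Finset.sup_univ_eq_iSup]
  exact this Finset.univ

instance : FiniteDimensional ℝ (cellSpace F k) := by
  unfold cellSpace; infer_instance

lemma finrank_cellSpace_le : Module.finrank ℝ (cellSpace F k) ≤
    ∑ i, Module.finrank ℝ (P0 (facePts F i) (k - 3)) + 6 * Module.finrank ℝ (Pk 3 (k - 4)) := by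
  refine (Submodule.finrank_mono cellSpace_le).trans ?_
  refine (Submodule.finrank_add_le_finrank_add_finrank _ _).trans (add_le_add ?_ ?_)
  · refine (finrank_iSup_fin_four_le _).trans (Finset.sum_le_sum fun i _ => ?_)
    exact (Submodule.finrank_map_le _ _).trans ((finrank_mulBy_le _ _).trans
      (Submodule.finrank_map_le _ _))
  · rw [finrank_symIn]
    exact Nat.mul_le_mul (by decide) (finrank_mulBy_le _ _)

lemma finrank_PkS (k : ℕ) : Module.finrank ℝ (PkS k) = (k + 1) * (k + 2) * (k + 3) := by
  rw [finrank_symIn, ← six_mul_finrank_Pk_three]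
  rfl

/-! ### Upper bounds for products of spaces of moments -/

section Products

lemma finrank_pi_le {ι : Type} [Fintype ι] {M : ι → Type} [∀ i, AddCommGroup (M i)]
    [∀ i, Module ℝ (M i)] [∀ i, FiniteDimensional ℝ (M i)] {c n : ℕ} (hn : Fintype.card ι = n)
    (h : ∀ i, Module.finrank ℝ (M i) ≤ c) : Module.finrank ℝ (∀ i, M i) ≤ n * c := by
  rw [Module.finrank_pi_fintype, ← hn]
  simpa using Finset.sum_le_card_nsmul Finset.univ _ c fun i _ => h i

/-- The dimension of a product of spaces of moments. -/
lemma finrank_pi_dual_le {ι V : Type} [Fintype ι] [AddCommGroup V] [Module ℝ V]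
    (W : ι → Submodule ℝ V) [∀ i, FiniteDimensional ℝ (W i)] {c n : ℕ} (hn : Fintype.card ι = n)
    (h : ∀ i, Module.finrank ℝ (W i) ≤ c) :
    Module.finrank ℝ (∀ i, Module.Dual ℝ (W i)) ≤ n * c :=
  finrank_pi_le hn fun i => Subspace.dual_finrank_eq.trans_le (h i)

lemma finrank_pi_pi_dual_le {ι κ V : Type} [Fintype ι] [Fintype κ] [AddCommGroup V] [Module ℝ V]
    (W : ι → Submodule ℝ V) [∀ i, FiniteDimensional ℝ (W i)] {c n m : ℕ}
    (hn : Fintype.card ι = n) (hm : Fintype.card κ = m) (h : ∀ i, Module.finrank ℝ (W i) ≤ c) :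
    Module.finrank ℝ (∀ i, κ → Module.Dual ℝ (W i)) ≤ n * (m * c) :=
  finrank_pi_le hn fun i => finrank_pi_le hm fun _ => Subspace.dual_finrank_eq.trans_le (h i)

variable {A B : Type} [AddCommGroup A] [Module ℝ A] [AddCommGroup B] [Module ℝ B]

lemma finrank_prod_le (a b : ℕ) (hA : FiniteDimensional ℝ A ∧ Module.finrank ℝ A ≤ a)
    (hB : FiniteDimensional ℝ B ∧ Module.finrank ℝ B ≤ b) :
    FiniteDimensional ℝ (A × B) ∧ Module.finrank ℝ (A × B) ≤ a + b := by
  obtain ⟨_, hA⟩ := hA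
  obtain ⟨_, hB⟩ := hB
  exact ⟨inferInstance, by rw [Module.finrank_prod]; omega⟩

end Products

/-! ### The total dimension count -/

lemma finrank_DofSpace_le (F : Frame K) (hk : 7 ≤ k) : FiniteDimensional ℝ (DofSpace F k) ∧
    Module.finrank ℝ (DofSpace F k) ≤ (k + 1) * (k + 2) * (k + 3) := by
  have hE : Fintype.card Edge = 6 := by decide
  have hN : Fintype.card NPair = 3 := by decide
  have hM : Fintype.card MIdx = 10 := by decide
  have hS : Module.finrank ℝ Sym3 = 6 := by
    rw [finrank_symIn, finrank_top, Module.finrank_self]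
    decide
  have hS2 : Fintype.card {p : Fin 2 × Fin 2 // p.1 ≤ p.2} = 3 := by decide
  have h0 : ∀ e, Module.finrank ℝ (edgeSpaceMod F k 0 e) ≤ k - 6 := fun e => by
    have := finrank_edgeSpaceMod_add_le (F := F) (k := k) (m := 0) (by omega) e
    omega
  have h1 : ∀ e, Module.finrank ℝ (edgeSpaceMod F k 1 e) ≤ k - 7 := fun e => by
    have := finrank_edgeSpaceMod_add_le (F := F) (k := k) (m := 1) (by omega) e
    omega
  -- `f` is `dim P_{k-3}(f) - 3`, a common bound for the four faces; the subtraction is not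
  -- truncated because `dim P0 + 3 ≤ dim P_{k-3}(f)`.
  obtain ⟨f, hf, hf'⟩ : ∃ f, (∀ i, Module.finrank ℝ (P0 (facePts F i) (k - 3)) ≤ f) ∧
      2 * f + 6 = (k - 3 + 1) * (k - 3 + 2) := by
    refine ⟨Module.finrank ℝ (Pk 2 (k - 3)) - 3, fun i => ?_, ?_⟩
    · have := (isDual_face F i).finrank_P0_add_le (m := k - 3) (by omega)
      omega
    · have := (isDual_face F 0).finrank_P0_add_le (m := k - 3) (by omega)
      rw [← two_mul_finrank_Pk_two]
      omega
  have hF := fun i => (finrank_faceSpace_le (F := F) (k := k) i).trans (hf i)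
  have hC := finrank_cellSpace_le (F := F) (k := k)
  have hC' := Finset.sum_le_card_nsmul Finset.univ _ f fun i _ => hf i
  rw [six_mul_finrank_Pk_three] at hC
  rw [Finset.card_univ, Fintype.card_fin, smul_eq_mul] at hC'
  have e1 := finrank_pi_dual_le (fun _ : Edge => RT) hE fun _ => finrank_RT_le
  have e2 : Module.finrank ℝ (Fin 4 → MIdx → Sym3) ≤ 4 * (10 * 6) :=
    finrank_pi_le (Fintype.card_fin 4) fun _ => finrank_pi_le hM fun _ => hS.le
  have e3 := finrank_pi_dual_le (fun e : Edge => edgeSpaceMod F k 1 e) hE h1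
  have e4 := finrank_pi_pi_dual_le (fun e : Edge => edgeSpaceMod F k 0 e) hE
    (Fintype.card_fin 2) h0
  have e5 := finrank_pi_pi_dual_le (fun e : Edge => edgeSpace F k e) hE hN finrank_edgeSpace_le
  have e6 := finrank_pi_dual_le (fun i : Fin 4 => faceSpaceS F k i) (c := 3 * f)
    (Fintype.card_fin 4) fun i => by
      rw [finrank_symIn, hS2]
      exact Nat.mul_le_mul_left 3 (hF i)
  have e7 := finrank_pi_dual_le (fun i : Fin 4 => faceSpaceV F k i) (c := 2 * f)
    (Fintype.card_fin 4) fun i => by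
      rw [finrank_vecIn]
      exact Nat.mul_le_mul_left 2 (hF i)
  have e8 : Module.finrank ℝ (Module.Dual ℝ (cellSpace F k)) ≤
      4 * f + (k - 4 + 1) * (k - 4 + 2) * (k - 4 + 3) :=
    Subspace.dual_finrank_eq.trans_le (hC.trans (Nat.add_le_add_right hC' _))
  obtain ⟨h, hle⟩ := finrank_prod_le _ _ ⟨inferInstance, e1⟩ <| finrank_prod_le _ _
    ⟨inferInstance, e2⟩ <| finrank_prod_le _ _ ⟨inferInstance, e3⟩ <| finrank_prod_le _ _
    ⟨inferInstance, e4⟩ <| finrank_prod_le _ _ ⟨inferInstance, e5⟩ <| finrank_prod_le _ _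
    ⟨inferInstance, e6⟩ <| finrank_prod_le _ _ ⟨inferInstance, e7⟩ ⟨inferInstance, e8⟩
  refine ⟨h, hle.trans ?_⟩
  -- Writing `k = 7 + n` removes the truncated subtractions. The sum is `24 + 240 + 6(k-7) + 12(k-6)
  -- + 18(k-5)` from edges and vertices, `12f + 8f` from faces and `4f + (k-3)(k-2)(k-1)` from the
  -- cell, linear in `f` with `2f + 6 = (k-2)(k-1)`.
  obtain ⟨n, rfl⟩ := Nat.exists_eq_add_of_le hk
  rw [show 7 + n - 3 = n + 4 by omega] at hf'
  rw [show 7 + n - 7 = n by omega, show 7 + n - 6 = n + 1 by omega,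
    show 7 + n - 4 = n + 3 by omega]
  linarith

end

end HuCurl

theorem mainTheorem10 (k : ℕ) (hk : 7 ≤ k) (K : HuCurl.Tet) (F : HuCurl.Frame K)
    (hf : ∀ i, HuCurl.IsInnerProductOn (HuCurl.faceFormS F k i) (HuCurl.faceSpaceS F k i))
    (hg : ∀ i, HuCurl.IsInnerProductOn (HuCurl.faceFormV F k i) (HuCurl.faceSpaceV F k i))
    (hh : HuCurl.IsInnerProductOn (HuCurl.cellForm K k) (HuCurl.cellSpace F k)) :
    Function.Bijective (HuCurl.dof F k) ∧
      Module.finrank ℝ (HuCurl.DofSpace F k) = (k + 1) * (k + 2) * (k + 3) ∧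
      Module.finrank ℝ (HuCurl.PkS k) = (k + 1) * (k + 2) * (k + 3) := by
  obtain ⟨_, hle⟩ := HuCurl.finrank_DofSpace_le F hk
  have hinj := HuCurl.dof_injective hk hf hg hh
  have hP := HuCurl.finrank_PkS k
  -- Injectivity gives the lower bound, so every upper bound in the count is sharp and surjectivity
  -- follows.
  have hD : Module.finrank ℝ (HuCurl.DofSpace F k) = (k + 1) * (k + 2) * (k + 3) :=
    le_antisymm hle (hP ▸ LinearMap.finrank_le_finrank_of_injective hinj)
  exact ⟨⟨hinj, (LinearMap.injective_iff_surjective_of_finrank_eq_finrank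
    (hP.trans hD.symm)).1 hinj⟩, hD, hP⟩
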